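/- There is a universal constant $c>0$ such that the following holds. **Setting.** Let $\mathcal X\subset\mathbb R^d$ be nonempty, compact and convex, let $\|\cdot\|$ be a norm on $\mathbb R^d$ with dual norm $\|x\|_*=\sup\{\langle u,x\rangle:\|u\|\le 1\}$, and put $\Psi_1=\sup_{x\ne0}\|x\|/\|x\|_2$, $\Psi_2=\sup_{x\neq 0}\|x\|_2/\|x\|$ and $D=\sup_{x,y\in\mathcal X}\|x-y\|$. Let $P$ be a probability distribution on $\mathbb R^d$ that is absolutely continuous with respect to Lebesgue measure, with $\eta=\mathbb E_{\sigma\sim P}\|\sigma\|_*<\infty$. Let $$\nabla\Phi(g)=\mathbb E_{\sigma\sim P}\big[\operatorname{argmin}_{x\in\mathcal X}\langle g-\sigma,x\rangle\big].$$ Let $C>0$ be such that the predictions are $C\eta^{-1}$-stable with respect to $\|\cdot\|_*$, where predictions are called $\beta$-stable with respect to a norm $\|\cdot\|'$ if $\|\nabla\Phi(g_1)-\nabla\Phi(g_2)\|'_*\le\beta\|g_1-g_2\|'$ for all $g_1,g_2\in\mathbb R^d$ (here $\|\cdot\|'_*$ is the dual norm of $\|\cdot\|'$). **Algorithm (Convex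 OFTPL).** Let $m\ge1$. In each round $t=1,\dots,T$ a guess $g_t\in\mathbb R^d$ is formed and the adversary chooses a convex differentiable loss $f_t:\mathcal X\to\mathbb R$; both may depend on everything that happened before the perturbations of round $t$ are drawn, and on additional randomness. The learner draws $\sigma_{t,1},\dots,\sigma_{t,m}$ i.i.d. from $P$, independently of all of this, computes $$x_{t,j}\in\operatorname{argmin}_{x\in\mathcal X}\Big\langle\sum_{i<t}\nabla_i+g_t-\sigma_{t,j},\,x\Big\rangle,$$ plays $x_t=\frac1m\sum_{j=1}^m x_{t,j}$, observes $f_t$, and sets $\nabla_t=\nabla f_t(x_t)$. Let $\tilde x_{t-1}$ be the prediction that the algorithm makes in round $t$ if the guess $0$ is used there, and let $x_t^\infty=\mathbb E[x_t\mid g_t,f_{1:t-1},x_{1:t-1}]$ and $\tilde x_{t-1}^\infty=\mathbb E[\tilde x_{t-1}\mid f_{1:t-1},x_{1:t-1}]$. **Losses.** Suppose that for all $t$ and all $x,y\in\mathcal X$ $$|f_t(x)-f_t(y)|\le G\|x-y\|,\qquad \|\nabla f_t(x)\|_*\le G,\qquad \|\nabla f_t(x)-\nabla f_t(y)\|_*\le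 L\|x-y\|^\alpha,$$ where $\alpha\in[0,1]$. **Conclusion.** For every $\delta\in(0,1)$, with probability at least $1-\delta$, $$\sup_{x\in\mathcal X}\sum_{t=1}^T\big(f_t(x_t)-f_t(x)\big)\le \eta D+\sum_{t=1}^T\frac{C}{2\eta}\|\nabla_t-g_t\|_*^2-\sum_{t=1}^T\frac{\eta}{2C}\|x_t^\infty-\tilde x_{t-1}^\infty\|^2+cGD\sqrt{\frac{T\log(2/\delta)}{m}}+cLT\left(\frac{\Psi_1^2\Psi_2^2D^2\log(4T/\delta)}{m}\right)^{\frac{1+\alpha}{2}}.$$ -/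

import Mathlib

open MeasureTheory ProbabilityTheory

noncomputable section

namespace OFTPL

/-- The space `ℝ^d` with its Euclidean inner product. -/
abbrev E (d : ℕ) : Type := EuclideanSpace ℝ (Fin d)

/-- The dual norm `‖x‖_* = sup {⟨u, x⟩ : ‖u‖ ≤ 1}` of a norm `N` on `ℝ^d`. -/
def dualNorm {d : ℕ} (N : E d → ℝ) (x : E d) : ℝ :=
  ⨆ u : {u : E d // N u ≤ 1}, inner ℝ u.1 x

/-- The compatibility constant `Ψ₁ = sup_{x ≠ 0} ‖x‖ / ‖x‖₂`. -/
def psi1 {d : ℕ} (N : E d → ℝ) : ℝ := ⨆ x : {x : E d // x ≠ 0}, N x.1 / ‖x.1‖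

/-- The compatibility constant `Ψ₂ = sup_{x ≠ 0} ‖x‖₂ / ‖x‖`. -/
def psi2 {d : ℕ} (N : E d → ℝ) : ℝ := ⨆ x : {x : E d // x ≠ 0}, ‖x.1‖ / N x.1

/-- The diameter `sup_{x, y ∈ X} ‖x - y‖` of `X` in the norm `N`. -/
def diameter {d : ℕ} (N : E d → ℝ) (X : Set (E d)) : ℝ := ⨆ p : X × X, N (p.1.1 - p.2.1)

/-- `x ∈ argmin_{y ∈ X} ⟨v, y⟩`. -/
def IsLinMin {d : ℕ} (X : Set (E d)) (v x : E d) : Prop :=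
  x ∈ X ∧ ∀ y ∈ X, inner ℝ v x ≤ inner ℝ v y

/-- A choice of an element of `argmin_{y ∈ X} ⟨v, y⟩`. -/
def linArgmin {d : ℕ} (X : Set (E d)) (v : E d) : E d := Classical.epsilon (IsLinMin X v)

/-- The prediction map `∇Φ(g) = E_{σ ∼ P} [argmin_{x ∈ X} ⟨g - σ, x⟩]` of the deterministic version
of the algorithm. For compact nonempty `X` and `P` absolutely continuous with respect to Lebesgue
measure the minimizer is unique for almost every `σ`. -/
def gradPhi {d : ℕ} (X : Set (E d)) (P : Measure (E d)) (g : E d) : E d :=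
  ∫ s, linArgmin X (g - s) ∂P

/-- The predictions are `β`-stable with respect to the norm `N`. -/
def IsStable {d : ℕ} (X : Set (E d)) (P : Measure (E d)) (N : E d → ℝ) (β : ℝ) : Prop :=
  ∀ g₁ g₂ : E d, dualNorm N (gradPhi X P g₁ - gradPhi X P g₂) ≤ β * N (g₁ - g₂)

/-- `s 0, …, s (m-1)` are i.i.d. samples from `P`, jointly independent of the information `𝒢`. -/
structure IsFreshSample {Ω : Type*} (𝒢 : MeasurableSpace Ω) {mΩ : MeasurableSpace Ω} {d m : ℕ}
    (μ : Measure Ω) (P : Measure (E d)) (s : Fin m → Ω → E d) : Prop where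
  measurable : ∀ j, Measurable (s j)
  law : ∀ j, μ.map (s j) = P
  iIndep : iIndepFun s μ
  indep : Indep (⨆ j, MeasurableSpace.comap (s j) inferInstance) 𝒢 μ

/-- The average `m⁻¹ ∑_j x_{t,j}` of the minimizers computed in round `t`. -/
def average {Ω : Type*} {d m : ℕ} (xs : ℕ → Fin m → Ω → E d) (t : ℕ) (ω : Ω) : E d :=
  (m : ℝ)⁻¹ • ∑ j, xs t j ω

/-- The gradient `∇_t = ∇f_t(x_t)` of the loss at the point played in round `t`. -/
def gradAt {Ω : Type*} {d : ℕ} (gradf : ℕ → Ω → E d → E d) (x : ℕ → Ω → E d)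
    (t : ℕ) (ω : Ω) : E d := gradf t ω (x t ω)

/-- The sum of the gradients `∇_i` over all rounds `i` before round `t`. -/
def cumGrad {Ω : Type*} {d : ℕ} (gradf : ℕ → Ω → E d → E d) (x : ℕ → Ω → E d)
    (t : ℕ) (ω : Ω) : E d := ∑ i ∈ Finset.range t, gradAt gradf x i ω

/-- The σ-algebra generated by the loss functions (values and gradients on `X`) and the points
played in the rounds before round `t`. The gradient `∇_i` is a function of the `i`-th loss and
the `i`-th point; it is listed because evaluation at a random point need not be measurable for the
σ-algebra generated by evaluations at fixed points. -/
@[reducible] def past {Ω : Type*} {d : ℕ} (X : Set (E d)) (f : ℕ → Ω → E d → ℝ)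
    (gradf : ℕ → Ω → E d → E d) (x : ℕ → Ω → E d) (t : ℕ) : MeasurableSpace Ω :=
  ⨆ i : Fin t,
    (⨆ y : X, MeasurableSpace.comap (fun ω => f i ω y) inferInstance
      ⊔ MeasurableSpace.comap (fun ω => gradf i ω y) inferInstance)
    ⊔ MeasurableSpace.comap (x i) inferInstance
    ⊔ MeasurableSpace.comap (gradAt gradf x i) inferInstance

/-- The σ-algebra generated by the guess of round `t` and by `past`. -/
@[reducible] def pastWithGuess {Ω : Type*} {d : ℕ} (X : Set (E d)) (f : ℕ → Ω → E d → ℝ)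
    (gradf : ℕ → Ω → E d → E d) (g : ℕ → Ω → E d) (x : ℕ → Ω → E d) (t : ℕ) :
    MeasurableSpace Ω :=
  MeasurableSpace.comap (g t) inferInstance ⊔ past X f gradf x t

/-- A run of `T` rounds, numbered `0, …, T-1`, of Convex OFTPL with `m` perturbations per round.
`ℱ t` is the information available when the perturbations of round `t` are drawn. The guess `g t`
and the (possibly adaptive and randomized) loss `f t`, with gradient `gradf t`, are determined by
`ℱ t`; the perturbations `σ t j` are i.i.d. from `P` and independent of `ℱ t`; then the learner
computes the minimizers `xs t j` and plays their average. -/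
structure IsRun {Ω : Type*} {mΩ : MeasurableSpace Ω} {d m : ℕ} (μ : Measure Ω)
    (ℱ : Filtration ℕ mΩ) (X : Set (E d)) (P : Measure (E d)) (T : ℕ)
    (f : ℕ → Ω → E d → ℝ) (gradf : ℕ → Ω → E d → E d) (g : ℕ → Ω → E d)
    (σ xs : ℕ → Fin m → Ω → E d) : Prop where
  loss_measurable : ∀ t < T, ∀ y ∈ X, Measurable[ℱ t] (fun ω => f t ω y)
  grad_measurable : ∀ t < T, Measurable[MeasurableSpace.prod (ℱ t) inferInstance]
    (fun p : Ω × X => gradf t p.1 p.2)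
  guess_measurable : ∀ t < T, Measurable[ℱ t] (g t)
  pert_sample : ∀ t < T, IsFreshSample (ℱ t) μ P (σ t)
  pert_measurable : ∀ t < T, ∀ j, Measurable[ℱ (t + 1)] (σ t j)
  point_measurable : ∀ t < T, ∀ j, Measurable[ℱ (t + 1)] (xs t j)
  point_min : ∀ t < T, ∀ j ω,
    IsLinMin X (cumGrad gradf (average xs) t ω + g t ω - σ t j ω) (xs t j ω)

/-- `ys t j` are the minimizers that the algorithm computes in round `t` when the guess `0` is used
there, from samples `τ t j` of `P` that are independent of the past losses and points (they may be
the perturbations of the run itself or drawn separately). -/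
structure IsZeroGuessRun {Ω : Type*} [MeasurableSpace Ω] {d m : ℕ} (μ : Measure Ω)
    (X : Set (E d)) (P : Measure (E d)) (T : ℕ)
    (f : ℕ → Ω → E d → ℝ) (gradf : ℕ → Ω → E d → E d) (x : ℕ → Ω → E d)
    (τ ys : ℕ → Fin m → Ω → E d) : Prop where
  pert_sample : ∀ t < T, IsFreshSample (past X f gradf x t) μ P (τ t)
  point_measurable : ∀ t < T, ∀ j, Measurable (ys t j)
  point_min : ∀ t < T, ∀ j ω, IsLinMin X (cumGrad gradf x t ω - τ t j ω) (ys t j ω)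

/-- The regret `sup_{x ∈ X} ∑_t (f_t(x_t) - f_t(x))`. -/
def regret {Ω : Type*} {d : ℕ} (X : Set (E d)) (T : ℕ) (f : ℕ → Ω → E d → ℝ)
    (x : ℕ → Ω → E d) (ω : Ω) : ℝ :=
  ⨆ y : X, ∑ t ∈ Finset.range T, (f t ω (x t ω) - f t ω y)

end OFTPL

end

/-! Write `z t = x_t^∞` for the conditional expectation of the played point; it equals `gradPhi` at
the accumulated gradients plus the guess. By convexity, `f_t(x_t) - f_t(y) ≤ ⟨∇_t, x_t - y⟩`, and
the right side splits into `⟨∇_t, z_t - y⟩`, `⟨∇f_t(z_t), x_t - z_t⟩` and `⟨∇_t - ∇f_t(z_t), x_t -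
z_t⟩` (`sum_loss_sub_le`).

The first sum is the regret of the expected predictions against linear losses, bounded pathwise for
arbitrary sequences (`linear_regret_le`), so it does not matter that `∇_t` depends on the
perturbations of round `t`. The potential `Φ(g) = E min_x ⟨g - σ, x⟩` is concave with gradient
`gradPhi`, and stability says that this gradient is Lipschitz. Smoothness pays for replacing the
guess by the true gradient, cocoercivity yields the negative terms, and `Φ(v) - Φ(0) ≤ ⟨v, x⟩ + η D`
brings in the comparator.

The second sum is a martingale, because `z_t` and `f_t` are fixed before the perturbations of round
`t` are drawn; Azuma–Hoeffding applies (`measure_sum_fresh_gt_le`). The third is at most `L ∑ ‖x_t -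
z_t‖^(1+α)`, where `x_t - z_t` is a mean of `m` conditionally independent centred vectors. A
dimension-free Hoeffding inequality controls it in the Euclidean norm (`measure_norm_sum_gt_le`),
and `Ψ₁`, `Ψ₂` translate between the norms.

Half of `δ` goes to the martingale, the other half is divided equally among the `T` rounds. -/

noncomputable section

namespace OFTPL

/-! ### Norms on `ℝ^d`, compatibility constants and duality. -/

section Norms

variable {d : ℕ} (N : Seminorm ℝ (E d))

theorem continuous_seminorm : Continuous N := by
  have h := N.convexOn.continuousOn isOpen_univ
  exact continuousOn_univ.1 h

theorem exists_seminorm_le : ∃ K, 0 < K ∧ ∀ x : E d, N x ≤ K * ‖x‖ :=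
  Seminorm.bound_of_continuous_normedSpace N (continuous_seminorm N)

theorem exists_norm_le (hN : ∀ x, N x = 0 → x = 0) : ∃ K, 0 < K ∧ ∀ x : E d, ‖x‖ ≤ K * N x := by
  -- The unit sphere is empty exactly when `d = 0`.
  rcases (Metric.sphere (0 : E d) 1).eq_empty_or_nonempty with he | hne
  · refine ⟨1, one_pos, fun x => ?_⟩
    by_cases hx : x = 0
    · simp [hx]
    · have : ‖x‖⁻¹ • x ∈ Metric.sphere (0 : E d) 1 := by
        simp [norm_smul, norm_ne_zero_iff.2 hx]
      rw [he] at this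
      exact this.elim
  · obtain ⟨z, hz, hmin⟩ := (isCompact_sphere (0 : E d) 1).exists_isMinOn hne
      (continuous_seminorm N).continuousOn
    have hz0 : z ≠ 0 := by
      rintro rfl
      simp at hz
    have hNz : 0 < N z := lt_of_le_of_ne (apply_nonneg N z) fun h => hz0 (hN z h.symm)
    refine ⟨(N z)⁻¹, inv_pos.2 hNz, fun x => ?_⟩
    by_cases hx : x = 0
    · simp [hx]
    · have hx' : 0 < ‖x‖ := norm_pos_iff.2 hx
      have hm : ‖x‖⁻¹ • x ∈ Metric.sphere (0 : E d) 1 := by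
        simp [norm_smul, hx'.ne']
      have h1 : N z ≤ N (‖x‖⁻¹ • x) := hmin hm
      rw [map_smul_eq_mul, norm_inv, norm_norm, inv_mul_eq_div, le_div_iff₀ hx'] at h1
      rwa [inv_mul_eq_div, le_div_iff₀ hNz, mul_comm]

/-- Boundedness is what gives the real-valued `⨆` its meaning: an unbounded family would have
supremum `0`. -/
theorem bddAbove_psi1 : BddAbove (Set.range fun x : {x : E d // x ≠ 0} => N x.1 / ‖x.1‖) := by
  obtain ⟨K, -, hK⟩ := exists_seminorm_le N
  refine ⟨K, ?_⟩
  rintro _ ⟨x, rfl⟩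
  exact (div_le_iff₀ (norm_pos_iff.2 x.2)).2 (hK x)

theorem seminorm_le_psi1_mul (x : E d) : N x ≤ psi1 N * ‖x‖ := by
  by_cases hx : x = 0
  · simp [hx]
  · exact (div_le_iff₀ (norm_pos_iff.2 hx)).1
      (le_ciSup (bddAbove_psi1 N) (⟨x, hx⟩ : {x : E d // x ≠ 0}))

theorem psi1_nonneg : 0 ≤ psi1 N :=
  Real.iSup_nonneg fun _ => div_nonneg (apply_nonneg N _) (norm_nonneg _)

theorem psi2_nonneg : 0 ≤ psi2 N :=
  Real.iSup_nonneg fun _ => div_nonneg (norm_nonneg _) (apply_nonneg N _)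

variable {N} in
theorem norm_le_psi2_mul (hN : ∀ x, N x = 0 → x = 0) (x : E d) : ‖x‖ ≤ psi2 N * N x := by
  by_cases hx : x = 0
  · simp [hx]
  · have pos : ∀ y : E d, y ≠ 0 → 0 < N y := fun y hy =>
      lt_of_le_of_ne (apply_nonneg N y) fun h => hy (hN y h.symm)
    obtain ⟨K, -, hK⟩ := exists_norm_le N hN
    have hb : BddAbove (Set.range fun x : {x : E d // x ≠ 0} => ‖x.1‖ / N x.1) := by
      refine ⟨K, ?_⟩
      rintro _ ⟨y, rfl⟩
      exact (div_le_iff₀ (pos _ y.2)).2 (hK y)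
    exact (div_le_iff₀ (pos x hx)).1 (le_ciSup hb (⟨x, hx⟩ : {x : E d // x ≠ 0}))

theorem diameter_nonneg (X : Set (E d)) : 0 ≤ diameter N X :=
  Real.iSup_nonneg fun _ => apply_nonneg N _

theorem seminorm_sub_le_diameter {X : Set (E d)} (hX : IsCompact X) {x y : E d} (hx : x ∈ X)
    (hy : y ∈ X) : N (x - y) ≤ diameter N X := by
  have hb : BddAbove (Set.range fun p : X × X => N (p.1.1 - p.2.1)) := by
    have h := ((hX.prod hX).image_of_continuousOn (f := fun p : E d × E d => N (p.1 - p.2))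
      ((continuous_seminorm N).comp (continuous_fst.sub continuous_snd)).continuousOn).bddAbove
    refine h.mono ?_
    rintro _ ⟨p, rfl⟩
    exact ⟨(p.1.1, p.2.1), ⟨p.1.2, p.2.2⟩, rfl⟩
  exact le_ciSup hb (⟨⟨x, hx⟩, ⟨y, hy⟩⟩ : X × X)

section Dual

variable {N}

theorem bddAbove_dualNorm (hN : ∀ x, N x = 0 → x = 0) (x : E d) :
    BddAbove (Set.range fun u : {u : E d // N u ≤ 1} => (inner ℝ u.1 x : ℝ)) := by
  obtain ⟨K, hK0, hK⟩ := exists_norm_le N hN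
  refine ⟨K * ‖x‖, ?_⟩
  rintro _ ⟨u, rfl⟩
  refine (real_inner_le_norm _ _).trans ?_
  have : ‖u.1‖ ≤ K := (hK u.1).trans (by nlinarith [u.2])
  gcongr

theorem inner_le_dualNorm (hN : ∀ x, N x = 0 → x = 0)
    {u x : E d} (hu : N u ≤ 1) : inner ℝ u x ≤ dualNorm N x :=
  le_ciSup (bddAbove_dualNorm hN x) (⟨u, hu⟩ : {u : E d // N u ≤ 1})

theorem dualNorm_nonneg (hN : ∀ x, N x = 0 → x = 0) (x : E d) : 0 ≤ dualNorm N x := by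
  simpa using inner_le_dualNorm hN (u := 0) (x := x) (by simp)

theorem inner_le_dualNorm_mul (hN : ∀ x, N x = 0 → x = 0)
    (x u : E d) : inner ℝ x u ≤ dualNorm N x * N u := by
  by_cases hu : u = 0
  · simp [hu]
  · have pos : 0 < N u := lt_of_le_of_ne (apply_nonneg N u) fun h => hu (hN u h.symm)
    have := inner_le_dualNorm hN (u := (N u)⁻¹ • u) (x := x) (by
      rw [map_smul_eq_mul, norm_inv, Real.norm_of_nonneg pos.le, inv_mul_cancel₀ pos.ne'])
    rw [real_inner_smul_left, inv_mul_eq_div, div_le_iff₀ pos, real_inner_comm] at this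
    exact this

theorem abs_inner_le_dualNorm_mul (hN : ∀ x, N x = 0 → x = 0)
    (x u : E d) : |inner ℝ x u| ≤ dualNorm N x * N u := by
  refine abs_le.2 ⟨?_, inner_le_dualNorm_mul hN x u⟩
  have := inner_le_dualNorm_mul hN x (-u)
  rw [inner_neg_right, map_neg_eq_map] at this
  linarith

theorem dualNorm_smul_of_nonneg {r : ℝ} (hr : 0 ≤ r) (x : E d) :
    dualNorm N (r • x) = r * dualNorm N x := by
  simp only [dualNorm, real_inner_smul_right]
  rw [Real.mul_iSup_of_nonneg hr]

theorem dualNorm_eq_zero (hN : ∀ x, N x = 0 → x = 0) {x : E d} (h : dualNorm N x = 0) : x = 0 := by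
  have := inner_le_dualNorm_mul hN x x
  rw [h, zero_mul] at this
  exact by
    rw [real_inner_self_eq_norm_sq] at this
    simpa using this

theorem norm_le_mul_dualNorm (hN : ∀ x, N x = 0 → x = 0) :
    ∃ K, 0 < K ∧ ∀ x : E d, ‖x‖ ≤ K * dualNorm N x := by
  obtain ⟨K, hK0, hK⟩ := exists_seminorm_le N
  refine ⟨K, hK0, fun x => ?_⟩
  by_cases hx : x = 0
  · simpa [hx] using mul_nonneg hK0.le (dualNorm_nonneg hN 0)
  · have hx' : 0 < ‖x‖ := norm_pos_iff.2 hx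
    have h := inner_le_dualNorm_mul hN x x
    rw [real_inner_self_eq_norm_mul_norm] at h
    have h2 : dualNorm N x * N x ≤ dualNorm N x * (K * ‖x‖) :=
      mul_le_mul_of_nonneg_left (hK x) (dualNorm_nonneg hN x)
    refine le_of_mul_le_mul_right ?_ hx'
    linarith

/-- A norming functional. -/
theorem exists_dualNorm_le_one (x : E d) : ∃ u : E d, dualNorm N u ≤ 1 ∧ inner ℝ u x = N x := by
  by_cases hx : x = 0
  · exact ⟨0, by simp [dualNorm], by simp [hx]⟩
  -- Hahn–Banach: extend `r • x ↦ r * N x` from the line through `x`, dominated by `N`; Riesz then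
  -- represents the extension by a vector.
  · obtain ⟨φ, hφ1, hφ2⟩ := exists_extension_of_le_sublinear
      (LinearPMap.mkSpanSingleton x (N x) hx) N
      (fun c hc y => by rw [map_smul_eq_mul, Real.norm_of_nonneg hc.le])
      (fun y z => map_add_le_add N y z) (by
        rintro ⟨y, hy⟩
        obtain ⟨r, rfl⟩ := Submodule.mem_span_singleton.1 hy
        rw [LinearPMap.mkSpanSingleton'_apply, map_smul_eq_mul, smul_eq_mul]
        exact mul_le_mul_of_nonneg_right (Real.le_norm_self r) (apply_nonneg N x))
    have hφx : φ x = N x := by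
      have h := hφ1 ⟨x, Submodule.mem_span_singleton_self x⟩
      have h2 := LinearPMap.mkSpanSingleton_apply ℝ ℝ (σ := RingHom.id ℝ) (x := x) hx (N x)
      exact h.trans h2
    refine ⟨(InnerProductSpace.toDual ℝ (E d)).symm (LinearMap.toContinuousLinearMap φ), ?_, ?_⟩
    · refine Real.iSup_le (fun u => ?_) zero_le_one
      rw [real_inner_comm, InnerProductSpace.toDual_symm_apply]
      exact (hφ2 u.1).trans u.2
    · rw [InnerProductSpace.toDual_symm_apply]
      exact hφx

/-- Half of biduality. Stability with respect to `dualNorm N` measures predictions in its dual; this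
turns it into a bound in `N`. -/
theorem seminorm_le_dualNorm_dualNorm (hN : ∀ x, N x = 0 → x = 0)
    (x : E d) : N x ≤ dualNorm (dualNorm N) x := by
  obtain ⟨u, hu, hux⟩ := exists_dualNorm_le_one x
  rw [← hux]
  have hb : BddAbove (Set.range fun u : {u : E d // dualNorm N u ≤ 1} => (inner ℝ u.1 x : ℝ)) := by
    refine ⟨N x, ?_⟩
    rintro _ ⟨v, rfl⟩
    refine (inner_le_dualNorm_mul hN v.1 x).trans ?_
    nlinarith [v.2, apply_nonneg N x]
  exact le_ciSup hb (⟨u, hu⟩ : {u : E d // dualNorm N u ≤ 1})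

end Dual

end Norms

/-! ### The perturbed linear minimum and its expectation. -/

section LinearMinimum

variable {d : ℕ}

/-- The optimal value `min_{x ∈ X} ⟨v, x⟩`. -/
def linMin (X : Set (E d)) (v : E d) : ℝ := inner ℝ v (linArgmin X v)

variable {X : Set (E d)}

theorem exists_isLinMin (hne : X.Nonempty) (hc : IsCompact X) (v : E d) : ∃ x, IsLinMin X v x := by
  obtain ⟨x, hx, hm⟩ := hc.exists_isMinOn hne (f := fun x => (inner ℝ v x : ℝ))
    (continuous_const.inner continuous_id).continuousOn
  exact ⟨x, hx, fun y hy => hm hy⟩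

theorem linArgmin_spec (hne : X.Nonempty) (hc : IsCompact X) (v : E d) :
    IsLinMin X v (linArgmin X v) := Classical.epsilon_spec (exists_isLinMin hne hc v)

theorem linMin_le (hne : X.Nonempty) (hc : IsCompact X) (v : E d) {x : E d} (hx : x ∈ X) :
    linMin X v ≤ inner ℝ v x := (linArgmin_spec hne hc v).2 x hx

theorem IsLinMin.inner_eq (hne : X.Nonempty) (hc : IsCompact X) {v x : E d} (h : IsLinMin X v x) :
    inner ℝ v x = linMin X v :=
  le_antisymm (h.2 _ (linArgmin_spec hne hc v).1) (linMin_le hne hc v h.1)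

/-- As a minimum of linear functions `linMin` is concave, and a minimizer at `v` is a supergradient
there. -/
theorem IsLinMin.linMin_le_add (hne : X.Nonempty) (hc : IsCompact X) {v x : E d}
    (h : IsLinMin X v x) (w : E d) : linMin X w ≤ linMin X v + inner ℝ x (w - v) := by
  rw [← h.inner_eq hne hc, inner_sub_right, real_inner_comm w x, real_inner_comm v x]
  linarith [linMin_le hne hc w h.1]

theorem exists_norm_bound (hc : IsCompact X) : ∃ R : NNReal, ∀ x ∈ X, ‖x‖ ≤ R := by
  obtain ⟨R, hR⟩ := hc.isBounded.exists_norm_le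
  exact ⟨R.toNNReal, fun x hx => (hR x hx).trans (Real.le_coe_toNNReal R)⟩

theorem lipschitzWith_linMin (hne : X.Nonempty) (hc : IsCompact X) {R : NNReal}
    (hR : ∀ x ∈ X, ‖x‖ ≤ R) : LipschitzWith R (linMin X) := by
  refine LipschitzWith.of_le_add_mul R fun w v => ?_
  have hx := linArgmin_spec hne hc v
  refine (hx.linMin_le_add hne hc w).trans ?_
  gcongr
  refine (real_inner_le_norm _ _).trans ?_
  rw [dist_eq_norm]
  gcongr
  exact hR _ hx.1

/-- Where the optimal value is differentiable, every minimizer is its gradient. -/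
theorem IsLinMin.hasFDerivAt (hne : X.Nonempty) (hc : IsCompact X) {v x : E d}
    (h : IsLinMin X v x) (hd : DifferentiableAt ℝ (linMin X) v) :
    HasFDerivAt (linMin X) (innerSL ℝ x) v := by
  have h1 : HasFDerivAt (fun w => linMin X v + inner ℝ x (w - v) - linMin X w)
      (innerSL ℝ x - fderiv ℝ (linMin X) v) v := by
    refine HasFDerivAt.sub ?_ hd.hasFDerivAt
    refine HasFDerivAt.const_add _ ?_
    exact ((innerSL ℝ x).hasFDerivAt (x := v - v)).comp (f := fun w => w - v) v ((hasFDerivAt_id v).sub_const v)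
  -- The affine majorant touches `linMin` at `v`, so the gap is minimal there and its derivative
  -- vanishes.
  have h2 : IsLocalMin (fun w => linMin X v + inner ℝ x (w - v) - linMin X w) v := by
    refine Filter.Eventually.of_forall fun w => ?_
    have := h.linMin_le_add hne hc w
    simp only [sub_self, inner_zero_right]
    linarith
  have h3 := h2.hasFDerivAt_eq_zero h1
  rw [sub_eq_zero] at h3
  rw [h3]
  exact hd.hasFDerivAt

open Classical in
/-- A measurable selection of a minimizer of `⟨v, ·⟩` for almost every `v`. -/
def selection (X : Set (E d)) (x₀ v : E d) : E d :=
  if DifferentiableAt ℝ (linMin X) v then gradient (linMin X) v else x₀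

/-- At points of differentiability the minimizer is the gradient, hence unique. Thus minimizers
chosen in any way, with no measurability known, can be replaced almost surely by one Borel function.
-/
theorem IsLinMin.eq_selection (hne : X.Nonempty) (hc : IsCompact X) {v x : E d}
    (h : IsLinMin X v x) (hd : DifferentiableAt ℝ (linMin X) v) (x₀ : E d) :
    x = selection X x₀ v := by
  rw [selection, if_pos hd, gradient, (h.hasFDerivAt hne hc hd).fderiv]
  exact ((InnerProductSpace.toDual ℝ (E d)).symm_apply_apply x).symm

theorem isLinMin_selection (hne : X.Nonempty) (hc : IsCompact X) {v : E d}
    (hd : DifferentiableAt ℝ (linMin X) v) (x₀ : E d) : IsLinMin X v (selection X x₀ v) := by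
  have h := linArgmin_spec hne hc v
  rwa [← h.eq_selection hne hc hd]

theorem selection_mem (hne : X.Nonempty) (hc : IsCompact X) {x₀ : E d} (hx₀ : x₀ ∈ X) (v : E d) :
    selection X x₀ v ∈ X := by
  by_cases hd : DifferentiableAt ℝ (linMin X) v
  · exact (isLinMin_selection hne hc hd x₀).1
  · rwa [selection, if_neg hd]

theorem measurable_selection (X : Set (E d)) (x₀ : E d) : Measurable (selection X x₀) := by
  classical
  refine Measurable.ite (measurableSet_of_differentiableAt ℝ (linMin X)) ?_ measurable_const
  exact (InnerProductSpace.toDual ℝ (E d)).symm.continuous.measurable.comp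
    (measurable_fderiv ℝ (linMin X))

/-- Rademacher's theorem for the Lipschitz function `linMin`, transported by the volume-preserving
map `s ↦ y - s`. -/
theorem ae_differentiableAt_sub (hne : X.Nonempty) (hc : IsCompact X) {P : Measure (E d)}
    (hP : P ≪ volume) (y : E d) : ∀ᵐ s ∂P, DifferentiableAt ℝ (linMin X) (y - s) := by
  obtain ⟨R, hR⟩ := exists_norm_bound hc
  have h := (lipschitzWith_linMin hne hc hR).ae_differentiableAt (μ := (volume : Measure (E d)))
  exact hP.ae_le ((Measure.measurePreserving_sub_left volume y).quasiMeasurePreserving.ae h)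

/-- The expected value of the perturbed linear minimum. -/
def potential (X : Set (E d)) (P : Measure (E d)) (g : E d) : ℝ := ∫ s, linMin X (g - s) ∂P

theorem gradPhi_eq_integral_selection (hne : X.Nonempty) (hc : IsCompact X) {P : Measure (E d)}
    (hP : P ≪ volume) (x₀ g : E d) : gradPhi X P g = ∫ s, selection X x₀ (g - s) ∂P := by
  refine integral_congr_ae ?_
  filter_upwards [ae_differentiableAt_sub hne hc hP g] with s hs
  exact (linArgmin_spec hne hc _).eq_selection hne hc hs x₀

variable {P : Measure (E d)} [IsProbabilityMeasure P]

theorem integrable_selection (hne : X.Nonempty) (hc : IsCompact X) {x₀ : E d} (hx₀ : x₀ ∈ X)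
    (g : E d) : Integrable (fun s => selection X x₀ (g - s)) P := by
  obtain ⟨R, hR⟩ := exists_norm_bound hc
  exact Integrable.of_bound
    ((measurable_selection X x₀).comp (measurable_const.sub measurable_id)).aestronglyMeasurable R
    (Filter.Eventually.of_forall fun s => hR _ (selection_mem hne hc hx₀ _))

theorem gradPhi_mem (hne : X.Nonempty) (hc : IsCompact X) (hconv : Convex ℝ X) (hP : P ≪ volume)
    (g : E d) : gradPhi X P g ∈ X := by
  obtain ⟨x₀, hx₀⟩ := id hne
  rw [gradPhi_eq_integral_selection hne hc hP x₀]
  exact hconv.integral_mem hc.isClosed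
    (Filter.Eventually.of_forall fun s => selection_mem hne hc hx₀ _)
    (integrable_selection hne hc hx₀ g)

theorem measurable_gradPhi (hne : X.Nonempty) (hc : IsCompact X) (hP : P ≪ volume) :
    Measurable (gradPhi X P) := by
  obtain ⟨x₀, hx₀⟩ := id hne
  have h : gradPhi X P = fun g => ∫ s, selection X x₀ (g - s) ∂P :=
    funext fun g => gradPhi_eq_integral_selection hne hc hP x₀ g
  rw [h]
  have hm : StronglyMeasurable (Function.uncurry fun g s : E d => selection X x₀ (g - s)) :=
    ((measurable_selection X x₀).comp (measurable_fst.sub measurable_snd)).stronglyMeasurable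
  exact hm.integral_prod_right.measurable

theorem integrable_linMin (hne : X.Nonempty) (hc : IsCompact X)
    (hs : Integrable (fun s : E d => s) P) (g : E d) :
    Integrable (fun s => linMin X (g - s)) P := by
  obtain ⟨R, hR⟩ := exists_norm_bound hc
  have hl := lipschitzWith_linMin hne hc hR
  refine Integrable.mono' (((integrable_const g).sub hs).norm.const_mul (R : ℝ))
    (hl.continuous.measurable.comp
      (measurable_const.sub measurable_id)).aestronglyMeasurable
    (Filter.Eventually.of_forall fun s => ?_)
  rw [linMin, Real.norm_eq_abs]
  refine (abs_real_inner_le_norm _ _).trans ?_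
  rw [mul_comm]
  exact mul_le_mul_of_nonneg_right (hR _ (linArgmin_spec hne hc _).1) (norm_nonneg _)

/-- Differentiation under the integral: the integrand is Lipschitz with a constant independent of
`s` and differentiable at `g` for almost every `s`. -/
theorem hasFDerivAt_potential (hne : X.Nonempty) (hc : IsCompact X) (hP : P ≪ volume)
    (hs : Integrable (fun s : E d => s) P) (g : E d) :
    HasFDerivAt (potential X P) (innerSL ℝ (gradPhi X P g)) g := by
  obtain ⟨R, hR⟩ := exists_norm_bound hc
  obtain ⟨x₀, hx₀⟩ := id hne
  have hl := lipschitzWith_linMin hne hc hR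
  have hi := integrable_selection (P := P) hne hc hx₀ g
  have h := (hasFDerivAt_integral_of_dominated_loc_of_lip (μ := P) (𝕜 := ℝ)
    (F := fun g s => linMin X (g - s)) (x₀ := g)
    (F' := fun s => innerSL ℝ (selection X x₀ (g - s))) (bound := fun _ => (R : ℝ))
    (s := Set.univ) Filter.univ_mem
    (Filter.Eventually.of_forall fun y => (integrable_linMin hne hc hs y).1)
    (integrable_linMin hne hc hs g)
    ((innerSL ℝ).integrable_comp hi).1
    (Filter.Eventually.of_forall fun s => by
      simp only [lipschitzOnWith_univ, Real.nnabs_coe]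
      refine LipschitzWith.of_dist_le_mul fun x y => ?_
      simpa using hl.dist_le_mul (x - s) (y - s))
    (integrable_const _)
    (by
      filter_upwards [ae_differentiableAt_sub hne hc hP g] with s hs
      have h1 := (isLinMin_selection hne hc hs x₀).hasFDerivAt hne hc hs
      exact h1.comp g ((hasFDerivAt_id g).sub_const s))).2
  rw [gradPhi_eq_integral_selection hne hc hP x₀, ← ContinuousLinearMap.integral_comp_comm _ hi]
  exact h

theorem potential_le_add (hne : X.Nonempty) (hc : IsCompact X) (hP : P ≪ volume)
    (hs : Integrable (fun s : E d => s) P) (v w : E d) :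
    potential X P w ≤ potential X P v + inner ℝ (gradPhi X P v) (w - v) := by
  obtain ⟨x₀, hx₀⟩ := id hne
  have hi := integrable_selection (P := P) hne hc hx₀ v
  have hv := integrable_linMin hne hc hs v
  rw [gradPhi_eq_integral_selection hne hc hP x₀, real_inner_comm, ← integral_inner hi, potential,
    potential, ← integral_add hv (hi.const_inner _)]
  refine integral_mono_ae (integrable_linMin hne hc hs w) (hv.add (hi.const_inner _)) ?_
  filter_upwards [ae_differentiableAt_sub hne hc hP v] with s hs
  have h := (isLinMin_selection hne hc hs x₀).linMin_le_add hne hc (w - s)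
  rw [sub_sub_sub_cancel_right, real_inner_comm] at h
  exact h

end LinearMinimum

/-! ### Smooth concave potentials in a general norm. -/

section Smoothness

variable {d : ℕ} {N : Seminorm ℝ (E d)} {Φ : E d → ℝ} {k : E d → E d} {β : ℝ}

/-- Along the segment the gradient moves by at most `β * t * ‖w‖_*`. Adding the quadratic `β/2 *
‖w‖_*² * t²` therefore makes the corrected function monotone on `[0, 1]`. -/
theorem smooth_lower_bound (hN : ∀ x, N x = 0 → x = 0)
    (hΦ : ∀ v, HasFDerivAt Φ (innerSL ℝ (k v)) v)
    (hk : ∀ v w, N (k v - k w) ≤ β * dualNorm N (v - w)) (a w : E d) :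
    Φ a + inner ℝ (k a) w - β / 2 * dualNorm N w ^ 2 ≤ Φ (a + w) := by
  have hd : ∀ t : ℝ, HasDerivAt
      (fun t : ℝ => Φ (a + t • w) - t * inner ℝ (k a) w + β / 2 * dualNorm N w ^ 2 * t ^ 2)
      (inner ℝ (k (a + t • w)) w - inner ℝ (k a) w + β * dualNorm N w ^ 2 * t) t := by
    intro t
    have h1 : HasDerivAt (fun t : ℝ => a + t • w) w t := by
      simpa using ((hasDerivAt_id t).smul_const w).const_add a
    have h2 : HasDerivAt (fun t : ℝ => Φ (a + t • w)) (inner ℝ (k (a + t • w)) w) t :=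
      HasFDerivAt.comp_hasDerivAt (f := fun t : ℝ => a + t • w) t (hΦ (a + t • w)) h1
    have h3 := (h2.sub ((hasDerivAt_id t).mul_const (inner ℝ (k a) w : ℝ))).add
      (((hasDerivAt_id t).pow 2).const_mul (β / 2 * dualNorm N w ^ 2))
    refine h3.congr_deriv ?_
    simp only [id, Nat.cast_ofNat, one_mul]
    ring
  have hm : MonotoneOn
      (fun t : ℝ => Φ (a + t • w) - t * inner ℝ (k a) w + β / 2 * dualNorm N w ^ 2 * t ^ 2)
      (Set.Icc 0 1) := by
    refine monotoneOn_of_deriv_nonneg (convex_Icc 0 1)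
      (fun t _ => (hd t).continuousAt.continuousWithinAt)
      (fun t _ => (hd t).differentiableAt.differentiableWithinAt) fun t ht => ?_
    rw [(hd t).deriv]
    rw [interior_Icc] at ht
    have h1 := abs_inner_le_dualNorm_mul hN w (k (a + t • w) - k a)
    rw [real_inner_comm, inner_sub_left] at h1
    have h2 := hk (a + t • w) a
    rw [add_sub_cancel_left, dualNorm_smul_of_nonneg ht.1.le] at h2
    have h3 := mul_le_mul_of_nonneg_left h2 (dualNorm_nonneg hN w)
    have h4 := (abs_le.1 h1).1
    nlinarith
  have h := hm (Set.left_mem_Icc.2 zero_le_one) (Set.right_mem_Icc.2 zero_le_one) zero_le_one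
  simp only [zero_smul, add_zero, one_smul] at h
  linarith

/-- Move from `a` in the norming direction `u` of `k a - k b` and compare the smooth lower bound at
`a` with the concave upper bound at `b`. The gain `n * r - β/2 * r²` is largest at step length `r =
n / β`. -/
theorem cocoercive_bound (hN : ∀ x, N x = 0 → x = 0) (hβ : 0 < β)
    (hΦ : ∀ v, HasFDerivAt Φ (innerSL ℝ (k v)) v)
    (hconc : ∀ v w, Φ w ≤ Φ v + inner ℝ (k v) (w - v))
    (hk : ∀ v w, N (k v - k w) ≤ β * dualNorm N (v - w)) (a b : E d) :
    inner ℝ (k b) (b - a) + 1 / (2 * β) * N (k b - k a) ^ 2 ≤ Φ b - Φ a := by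
  obtain ⟨u, hu, hux⟩ := exists_dualNorm_le_one (N := N) (k a - k b)
  set n := N (k a - k b) with hn
  have hn0 : 0 ≤ n := apply_nonneg N _
  have h1 := smooth_lower_bound hN hΦ hk a ((n / β) • u)
  have h2 := hconc b (a + (n / β) • u)
  rw [dualNorm_smul_of_nonneg (by positivity)] at h1
  rw [add_sub_right_comm, inner_add_right] at h2
  rw [inner_smul_right] at h1 h2
  rw [inner_sub_right, real_inner_comm, real_inner_comm (k b)] at hux
  have h3 : inner ℝ (k b) (b - a) = - (inner ℝ (k b) (a - b) : ℝ) := by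
    rw [← neg_sub a b, inner_neg_right]
  have h4 : N (k b - k a) = n := by rw [hn, map_sub_rev]
  have h5 : dualNorm N u ^ 2 ≤ 1 := by
    have := dualNorm_nonneg hN u
    nlinarith
  have h6 : β / 2 * (n / β * dualNorm N u) ^ 2 ≤ n ^ 2 / (2 * β) := by
    have : β / 2 * (n / β * dualNorm N u) ^ 2 = n ^ 2 / (2 * β) * dualNorm N u ^ 2 := by
      field_simp
    rw [this]
    exact mul_le_of_le_one_right (by positivity) h5
  have h7 : n / β * inner ℝ (k a) u - n / β * inner ℝ (k b) u = n ^ 2 / β := by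
    rw [← mul_sub, hux]
    ring
  have h8 : n ^ 2 / β = n ^ 2 / (2 * β) + n ^ 2 / (2 * β) := by
    field_simp
    ring
  have h9 : 1 / (2 * β) * n ^ 2 = n ^ 2 / (2 * β) := by ring
  rw [h3, h4, h9]
  linarith

/-- The step of `Φ` from `S` to `S + l` is taken through `S + g`: cocoercivity bounds the part from
`S` to `S + g`, smoothness the part from `S + g` to `S + l`. -/
theorem potential_growth (hN : ∀ x, N x = 0 → x = 0) (hβ : 0 < β)
    (hΦ : ∀ v, HasFDerivAt Φ (innerSL ℝ (k v)) v)
    (hconc : ∀ v w, Φ w ≤ Φ v + inner ℝ (k v) (w - v))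
    (hk : ∀ v w, N (k v - k w) ≤ β * dualNorm N (v - w)) (l g : ℕ → E d) (T : ℕ) :
    ∑ t ∈ Finset.range T, inner ℝ (l t) (k (∑ i ∈ Finset.range t, l i + g t)) ≤
      Φ (∑ i ∈ Finset.range T, l i) - Φ 0
        + ∑ t ∈ Finset.range T, β / 2 * dualNorm N (l t - g t) ^ 2
        - ∑ t ∈ Finset.range T, 1 / (2 * β) *
            N (k (∑ i ∈ Finset.range t, l i + g t) - k (∑ i ∈ Finset.range t, l i)) ^ 2 := by
  induction T with
  | zero => simp
  | succ T ih =>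
    simp only [Finset.sum_range_succ _ T]
    set S := ∑ i ∈ Finset.range T, l i
    have h1 := smooth_lower_bound hN hΦ hk (S + g T) (l T - g T)
    have h2 := cocoercive_bound hN hβ hΦ hconc hk S (S + g T)
    have e : S + g T + (l T - g T) = S + l T := by abel
    rw [e, inner_sub_right] at h1
    rw [add_sub_cancel_left] at h2
    rw [real_inner_comm] at h1
    linarith

end Smoothness

/-! ### Regret of the expected predictions against linear losses. -/

section LinearRegret

variable {d : ℕ} {N : Seminorm ℝ (E d)} {X : Set (E d)} {P : Measure (E d)}

theorem integrable_id_of_dualNorm (hN : ∀ x, N x = 0 → x = 0)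
    (h : Integrable (dualNorm N) P) : Integrable (fun s : E d => s) P := by
  obtain ⟨K, -, hK⟩ := norm_le_mul_dualNorm hN
  exact Integrable.mono' (h.const_mul K) measurable_id.aestronglyMeasurable
    (Filter.Eventually.of_forall hK)

variable [IsProbabilityMeasure P]

/-- A zero mean would concentrate `P` at the origin, a Lebesgue null set when `d > 0`. -/
theorem integral_dualNorm_pos (hN : ∀ x, N x = 0 → x = 0) [Nontrivial (E d)] (hP : P ≪ volume)
    (h : Integrable (dualNorm N) P) : 0 < ∫ s, dualNorm N s ∂P := by
  refine lt_of_le_of_ne (integral_nonneg fun s => dualNorm_nonneg hN s) fun h0 => ?_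
  have h1 := (integral_eq_zero_iff_of_nonneg (fun s => dualNorm_nonneg hN s) h).1 h0.symm
  have h2 : P {0} = 0 := hP (measure_singleton 0)
  have h3 : P {0}ᶜ = 0 := by
    refine measure_mono_null (fun s hs => ?_) (ae_iff.1 h1)
    exact fun h => hs (dualNorm_eq_zero hN h)
  have h4 := measure_add_measure_compl (μ := P) (measurableSet_singleton (0 : E d))
  rw [h2, h3, add_zero, measure_univ] at h4
  exact zero_ne_one h4

/-- For each `s`, test the first minimum with `x` and keep the minimizer `y` of the second: the
difference is at most `⟨v, x⟩ + ⟨s, y - x⟩`. -/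
theorem potential_sub_le (hN : ∀ x, N x = 0 → x = 0) (hne : X.Nonempty) (hc : IsCompact X)
    (h : Integrable (dualNorm N) P) (v : E d) {x : E d} (hx : x ∈ X) :
    potential X P v - potential X P 0 ≤
      inner ℝ v x + (∫ s, dualNorm N s ∂P) * diameter N X := by
  have hs := integrable_id_of_dualNorm hN h
  have h1 := integrable_linMin (P := P) hne hc hs v
  have h2 := integrable_linMin (P := P) hne hc hs 0
  rw [potential, potential, ← integral_sub h1 h2]
  have e : ∫ s, (inner ℝ v x + dualNorm N s * diameter N X) ∂P =
      inner ℝ v x + (∫ s, dualNorm N s ∂P) * diameter N X := by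
    rw [integral_add (integrable_const _) (h.mul_const _), integral_const, integral_mul_const]
    simp
  rw [← e]
  refine integral_mono (h1.sub h2) ((integrable_const _).add (h.mul_const _)) fun s => ?_
  have h3 := linMin_le hne hc (v - s) hx
  have hm := linArgmin_spec hne hc (0 - s)
  have h4 := inner_le_dualNorm_mul hN s (linArgmin X (0 - s) - x)
  have h5 := mul_le_mul_of_nonneg_left (seminorm_sub_le_diameter N hc hm.1 hx)
    (dualNorm_nonneg hN s)
  have h6 : linMin X (0 - s) = - inner ℝ s (linArgmin X (0 - s)) := by
    rw [linMin, inner_sub_left, inner_zero_left, zero_sub]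
  rw [inner_sub_left] at h3
  rw [inner_sub_right] at h4
  linarith

/-- The regret of the expected predictions against linear losses. -/
theorem linear_regret_le (hN : ∀ x, N x = 0 → x = 0) (hne : X.Nonempty) (hc : IsCompact X)
    (hP : P ≪ volume) (h : Integrable (dualNorm N) P) {C η : ℝ}
    (hη : η = ∫ s, dualNorm N s ∂P) (hC : 0 < C) (hstab : IsStable X P (dualNorm N) (C * η⁻¹))
    (l g : ℕ → E d) (T : ℕ) {x : E d} (hx : x ∈ X) :
    ∑ t ∈ Finset.range T, inner ℝ (l t) (gradPhi X P (∑ i ∈ Finset.range t, l i + g t) - x) ≤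
      η * diameter N X
        + ∑ t ∈ Finset.range T, C / (2 * η) * dualNorm N (l t - g t) ^ 2
        - ∑ t ∈ Finset.range T, η / (2 * C) *
            N (gradPhi X P (∑ i ∈ Finset.range t, l i + g t)
              - gradPhi X P (∑ i ∈ Finset.range t, l i)) ^ 2 := by
  -- For `d = 0` the mean `η` is zero and division by it takes the default value, but every other
  -- quantity vanishes too.
  rcases subsingleton_or_nontrivial (E d) with hsub | hnt
  · have z : ∀ y : E d, y = 0 := fun y => Subsingleton.elim _ _
    have hη0 : 0 ≤ η := hη ▸ integral_nonneg fun s => dualNorm_nonneg hN s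
    have z2 : ∀ y : E d, dualNorm N y = 0 := fun y => by
      rw [z y]
      simp [dualNorm]
    have z3 : ∀ y : E d, N y = 0 := fun y => by rw [z y, map_zero]
    have z4 : ∀ y w : E d, (inner ℝ y w : ℝ) = 0 := fun y w => by rw [z y, inner_zero_left]
    simp only [z2, z3, z4]
    simpa using mul_nonneg hη0 (diameter_nonneg N X)
  · have hη0 : 0 < η := hη ▸ integral_dualNorm_pos hN hP h
    have hs := integrable_id_of_dualNorm hN h
    have h1 := potential_growth hN (Φ := potential X P) (k := gradPhi X P)
      (mul_pos hC (inv_pos.2 hη0)) (hasFDerivAt_potential hne hc hP hs)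
      (potential_le_add hne hc hP hs)
      (fun v w => (seminorm_le_dualNorm_dualNorm hN _).trans (hstab v w)) l g T
    have h2 := potential_sub_le hN hne hc h (∑ i ∈ Finset.range T, l i) hx
    rw [← hη, sum_inner] at h2
    have e1 : C * η⁻¹ / 2 = C / (2 * η) := by field_simp
    have e2 : 1 / (2 * (C * η⁻¹)) = η / (2 * C) := by field_simp
    rw [e1, e2] at h1
    simp only [inner_sub_right, Finset.sum_sub_distrib]
    linarith

end LinearRegret

/-! ### Exponential moments of bounded independent variables and vectors. -/

section Concentration

theorem hasSum_cosh_sqrt {s : ℝ} (hs : 0 ≤ s) :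
    HasSum (fun n : ℕ => s ^ n / ((2 * n).factorial : ℝ)) (Real.cosh √s) := by
  have h := Real.hasSum_cosh √s
  simpa only [pow_mul, Real.sq_sqrt hs] using h

/-- The power series of `cosh √s` in `s` has nonnegative coefficients. -/
theorem convexOn_cosh_sqrt : ConvexOn ℝ (Set.Ici 0) fun s => Real.cosh √s := by
  refine ⟨convex_Ici 0, fun s hs t ht a b ha hb hab => ?_⟩
  have h1 := ((hasSum_cosh_sqrt hs).mul_left a).add ((hasSum_cosh_sqrt ht).mul_left b)
  have h2 := hasSum_cosh_sqrt ((convex_Ici (0 : ℝ)) hs ht ha hb hab)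
  refine hasSum_le (fun n => ?_) h2 h1
  rw [← mul_div_assoc, ← mul_div_assoc, ← add_div]
  gcongr
  exact (convexOn_pow n).2 hs ht ha hb hab

/-- The argument is the convex combination of `(p + q)²` and `(p - q)²` with weights `(1 ± c)/2`.
With `c` the cosine of an angle, it is the squared norm of a sum of two vectors. -/
theorem cosh_sqrt_le {p q c : ℝ} (hc : |c| ≤ 1) :
    Real.cosh √(p ^ 2 + q ^ 2 + 2 * (c * (p * q))) ≤
      Real.cosh p * Real.cosh q + c * (Real.sinh p * Real.sinh q) := by
  obtain ⟨h1, h2⟩ := abs_le.1 hc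
  have h := convexOn_cosh_sqrt.2 (Set.mem_Ici.2 (sq_nonneg (p + q)))
    (Set.mem_Ici.2 (sq_nonneg (p - q)))
    (show 0 ≤ (1 + c) / 2 by linarith) (show 0 ≤ (1 - c) / 2 by linarith) (by ring)
  simp only [smul_eq_mul, Real.sqrt_sq_eq_abs, Real.cosh_abs, Real.cosh_add, Real.cosh_sub] at h
  have e : (1 + c) / 2 * (p + q) ^ 2 + (1 - c) / 2 * (p - q) ^ 2 =
      p ^ 2 + q ^ 2 + 2 * (c * (p * q)) := by ring
  rw [e] at h
  linarith

theorem exp_le_add_exp_sq (x : ℝ) : Real.exp x ≤ x + Real.exp (x ^ 2) := by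
  have h1 := Real.add_one_le_exp (x ^ 2)
  by_cases hx : |x| ≤ 1
  · have h := (abs_le.1 (Real.abs_exp_sub_one_sub_id_le hx)).2
    linarith
  · rcases lt_abs.1 (not_le.1 hx) with h | h
    · have : Real.exp x ≤ Real.exp (x ^ 2) := Real.exp_le_exp.2 (by nlinarith)
      linarith
    · have : Real.exp x ≤ 1 := Real.exp_le_one_iff.2 (by linarith)
      nlinarith

theorem norm_sum_le_card_mul {H Ω ι : Type*} [NormedAddCommGroup H] {Z : ι → Ω → H} {b : ℝ}
    (hb : ∀ i ω, ‖Z i ω‖ ≤ b) (s : Finset ι) (ω : Ω) :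
    ‖∑ i ∈ s, Z i ω‖ ≤ s.card * b := by
  simpa using norm_sum_le_of_le s fun i _ => hb i ω

theorem integrable_cosh_norm_sum {H Ω ι : Type*} [NormedAddCommGroup H] [MeasurableSpace H]
    [BorelSpace H] [SecondCountableTopology H] {mΩ : MeasurableSpace Ω} {μ : Measure Ω}
    [IsProbabilityMeasure μ] {Z : ι → Ω → H} {b : ℝ}
    (hm : ∀ i, Measurable (Z i)) (hb : ∀ i ω, ‖Z i ω‖ ≤ b)
    (s : Finset ι) : Integrable (fun ω => Real.cosh ‖∑ i ∈ s, Z i ω‖) μ := by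
  refine Integrable.of_bound (Real.measurable_cosh.comp
    (Finset.measurable_fun_sum s fun i _ => hm i).norm).aestronglyMeasurable
    (Real.cosh (s.card * b)) (Filter.Eventually.of_forall fun ω => ?_)
  rw [Real.norm_of_nonneg (Real.cosh_pos _).le, Real.cosh_le_cosh, abs_norm]
  exact (norm_sum_le_card_mul hb s ω).trans (le_abs_self _)

variable {H : Type*} [NormedAddCommGroup H] [InnerProductSpace ℝ H]

/-- One step of the supermartingale argument: the last term is linear in `z`, so it disappears in
expectation when `z` is centred and independent of `x`. -/
theorem cosh_norm_add_le (x z : H) :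
    Real.cosh ‖x + z‖ ≤ Real.cosh ‖x‖ * Real.exp (‖z‖ ^ 2)
      + inner ℝ ((Real.sinh ‖x‖ / ‖x‖) • x) z := by
  have hz := exp_le_add_exp_sq ‖z‖
  rw [← Real.cosh_add_sinh] at hz
  have hs : ‖z‖ ≤ Real.sinh ‖z‖ := Real.self_le_sinh_iff.2 (norm_nonneg z)
  have hsx : 0 ≤ Real.sinh ‖x‖ := Real.sinh_nonneg_iff.2 (norm_nonneg x)
  have hcx := Real.cosh_pos ‖x‖
  by_cases hx : x = 0
  · simp [hx]
    linarith
  by_cases hz0 : z = 0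
  · simp [hz0]
  have hp : 0 < ‖x‖ := norm_pos_iff.2 hx
  have hq : 0 < ‖z‖ := norm_pos_iff.2 hz0
  set c : ℝ := inner ℝ x z / (‖x‖ * ‖z‖) with hc
  have hc1 : |c| ≤ 1 := abs_real_inner_div_norm_mul_norm_le_one x z
  have hcm : c * (‖x‖ * ‖z‖) = inner ℝ x z := div_mul_cancel₀ _ (by positivity)
  have h := cosh_sqrt_le (p := ‖x‖) (q := ‖z‖) hc1
  have e : ‖x‖ ^ 2 + ‖z‖ ^ 2 + 2 * (c * (‖x‖ * ‖z‖)) = ‖x + z‖ ^ 2 := by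
    rw [hcm, norm_add_sq_real]
    ring
  rw [e, Real.sqrt_sq (norm_nonneg _)] at h
  have e2 : inner ℝ ((Real.sinh ‖x‖ / ‖x‖) • x) z = Real.sinh ‖x‖ * (c * ‖z‖) := by
    rw [real_inner_smul_left, ← hcm]
    field_simp
  rw [e2]
  -- Trading `sinh ‖z‖` for `‖z‖` costs `cosh ‖x‖ * (sinh ‖z‖ - ‖z‖)`; together with `cosh ‖z‖` this
  -- makes `exp ‖z‖ - ‖z‖ ≤ exp (‖z‖²)`.
  have h1 : c * (Real.sinh ‖x‖ * (Real.sinh ‖z‖ - ‖z‖)) ≤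
      Real.cosh ‖x‖ * (Real.sinh ‖z‖ - ‖z‖) := by
    have h3 : Real.sinh ‖x‖ * (Real.sinh ‖z‖ - ‖z‖) ≤ Real.cosh ‖x‖ * (Real.sinh ‖z‖ - ‖z‖) :=
      mul_le_mul_of_nonneg_right (Real.sinh_lt_cosh _).le (by linarith)
    refine le_trans ?_ h3
    exact mul_le_of_le_one_left (mul_nonneg hsx (by linarith)) (abs_le.1 hc1).2
  have h2 := mul_le_mul_of_nonneg_left hz hcx.le
  nlinarith

variable [MeasurableSpace H] [BorelSpace H] [SecondCountableTopology H] [CompleteSpace H]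
  {Ω ι : Type*} {mΩ : MeasurableSpace Ω} {μ : Measure Ω} [IsProbabilityMeasure μ]
  {Z : ι → Ω → H} {b : ℝ}

theorem integral_cosh_norm_sum_le (hm : ∀ i, Measurable (Z i)) (hind : iIndepFun Z μ)
    (h0 : ∀ i, ∫ ω, Z i ω ∂μ = 0) (hb : ∀ i ω, ‖Z i ω‖ ≤ b) (s : Finset ι) :
    ∫ ω, Real.cosh ‖∑ i ∈ s, Z i ω‖ ∂μ ≤ Real.exp (b ^ 2) ^ s.card := by
  classical
  induction s using Finset.induction_on with
  | empty => simp
  | insert i s hi ih =>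
    have hS : Measurable fun ω => ∑ j ∈ s, Z j ω := Finset.measurable_fun_sum s fun j _ => hm j
    have hw : Measurable fun x : H => (Real.sinh ‖x‖ / ‖x‖) • x :=
      ((Real.measurable_sinh.comp measurable_norm).div measurable_norm).smul measurable_id
    have hnw : ∀ x : H, ‖(Real.sinh ‖x‖ / ‖x‖) • x‖ = Real.sinh ‖x‖ := fun x => by
      by_cases hx : x = 0
      · simp [hx]
      · have hx' : 0 < ‖x‖ := norm_pos_iff.2 hx
        rw [norm_smul, Real.norm_of_nonneg
          (div_nonneg (Real.sinh_nonneg_iff.2 hx'.le) hx'.le), div_mul_cancel₀ _ hx'.ne']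
    have hindep : IndepFun (fun ω => ∑ j ∈ s, Z j ω) (Z i) μ := by
      have := hind.indepFun_finsetSum_of_notMem hm hi
      convert this using 1
      ext ω
      simp
    have hindep' := hindep.comp hw measurable_id
    have hZi : Integrable (Z i) μ := Integrable.of_bound (hm i).aestronglyMeasurable b
      (Filter.Eventually.of_forall (hb i))
    have hwi : Integrable (fun ω => (Real.sinh ‖∑ j ∈ s, Z j ω‖ / ‖∑ j ∈ s, Z j ω‖) •
        ∑ j ∈ s, Z j ω) μ := by
      refine Integrable.of_bound (hw.comp hS).aestronglyMeasurable
        (Real.sinh (s.card * b)) (Filter.Eventually.of_forall fun ω => ?_)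
      rw [hnw, Real.sinh_le_sinh]
      exact norm_sum_le_card_mul hb s ω
    have hcr : ∫ ω, inner ℝ ((Real.sinh ‖∑ j ∈ s, Z j ω‖ / ‖∑ j ∈ s, Z j ω‖) •
        ∑ j ∈ s, Z j ω) (Z i ω) ∂μ = 0 := by
      have := hindep'.integral_bilin hwi hZi (innerSL ℝ)
      simp only [h0 i, id, Function.comp_def, map_zero] at this
      exact this
    have hcri : Integrable (fun ω => inner ℝ ((Real.sinh ‖∑ j ∈ s, Z j ω‖ /
        ‖∑ j ∈ s, Z j ω‖) • ∑ j ∈ s, Z j ω) (Z i ω)) μ := by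
      refine Integrable.of_bound ((hw.comp hS).inner (hm i)).aestronglyMeasurable
        (Real.sinh (s.card * b) * b) (Filter.Eventually.of_forall fun ω => ?_)
      refine (norm_inner_le_norm _ _).trans ?_
      rw [hnw]
      have h1 := Real.sinh_le_sinh.2 (norm_sum_le_card_mul hb s ω)
      have h2 := Real.sinh_nonneg_iff.2 (norm_nonneg (∑ j ∈ s, Z j ω))
      exact mul_le_mul h1 (hb i ω) (norm_nonneg _) (h2.trans h1)
    calc ∫ ω, Real.cosh ‖∑ j ∈ insert i s, Z j ω‖ ∂μ
        ≤ ∫ ω, (Real.cosh ‖∑ j ∈ s, Z j ω‖ * Real.exp (b ^ 2)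
          + inner ℝ ((Real.sinh ‖∑ j ∈ s, Z j ω‖ / ‖∑ j ∈ s, Z j ω‖) •
            ∑ j ∈ s, Z j ω) (Z i ω)) ∂μ := by
          refine integral_mono (integrable_cosh_norm_sum hm hb _)
            (((integrable_cosh_norm_sum hm hb s).mul_const _).add hcri) fun ω => ?_
          simp only [Finset.sum_insert hi]
          rw [add_comm]
          refine (cosh_norm_add_le _ _).trans ?_
          gcongr
          exact hb i ω
      _ = (∫ ω, Real.cosh ‖∑ j ∈ s, Z j ω‖ ∂μ) * Real.exp (b ^ 2) := by
          rw [integral_add ((integrable_cosh_norm_sum hm hb s).mul_const _) hcri, hcr,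
            integral_mul_const, add_zero]
      _ ≤ Real.exp (b ^ 2) ^ (insert i s).card := by
          rw [Finset.card_insert_of_notMem hi, pow_succ (Real.exp (b ^ 2))]
          gcongr

/-- A dimension-free Hoeffding inequality for sums of independent bounded vectors. -/
theorem measure_norm_sum_gt_le [Fintype ι] (hm : ∀ i, Measurable (Z i)) (hind : iIndepFun Z μ)
    (h0 : ∀ i, ∫ ω, Z i ω ∂μ = 0) (hb0 : 0 ≤ b) (hb : ∀ i ω, ‖Z i ω‖ ≤ b) {l : ℝ} (hl : 0 ≤ l) :
    μ {ω | 2 * b * √(Fintype.card ι * l) < ‖∑ i, Z i ω‖} ≤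
      ENNReal.ofReal (2 * Real.exp (-l)) := by
  rcases (mul_nonneg (Nat.cast_nonneg (Fintype.card ι)) hb0).eq_or_lt with hz | hz
  · have he : {ω | 2 * b * √(Fintype.card ι * l) < ‖∑ i, Z i ω‖} = ∅ := by
      refine Set.eq_empty_of_forall_notMem fun ω hω => ?_
      have h1 := norm_sum_le_card_mul hb Finset.univ ω
      rw [Finset.card_univ, ← hz] at h1
      exact absurd (lt_of_le_of_lt (by positivity) hω) (not_lt.2 h1)
    rw [he]
    simp
  · have hb' : 0 < b := pos_of_mul_pos_right hz (Nat.cast_nonneg _)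
    set n : ℝ := (Fintype.card ι : ℝ)
    have hn : 0 < n := pos_of_mul_pos_left hz hb0
    -- With this scale the moment bound is `exp l`, while at the threshold `cosh` is at least `exp
    -- (2 * l) / 2`; Markov's inequality gives `2 * exp (-l)`.
    set c : ℝ := √(l / n) / b with hc
    have hc0 : 0 ≤ c := by positivity
    have hcb : ∀ i ω, ‖c • Z i ω‖ ≤ c * b := fun i ω => by
      rw [norm_smul, Real.norm_of_nonneg hc0]
      exact mul_le_mul_of_nonneg_left (hb i ω) hc0
    have h := integral_cosh_norm_sum_le (Z := fun i ω => c • Z i ω) (b := c * b) (μ := μ)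
      (fun i => (hm i).const_smul c)
      (hind.comp (fun _ x => c • x) fun _ => measurable_const_smul c)
      (fun i => by rw [integral_smul, h0, smul_zero])
      hcb Finset.univ
    rw [← Real.exp_nat_mul, Finset.card_univ] at h
    have e1 : n * (c * b) ^ 2 = l := by
      rw [hc, div_mul_cancel₀ _ hb'.ne', Real.sq_sqrt (by positivity)]
      field_simp
    rw [e1] at h
    have e2 : c * (2 * b * √(n * l)) = 2 * l := by
      have : √(l / n) * √(n * l) = l := by
        rw [← Real.sqrt_mul (by positivity)]
        have : l / n * (n * l) = l ^ 2 := by field_simp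
        rw [this, Real.sqrt_sq hl]
      calc √(l / n) / b * (2 * b * √(n * l)) = 2 * (√(l / n) * √(n * l)) := by field_simp
        _ = 2 * l := by rw [this]
    have hM := mul_meas_ge_le_integral_of_nonneg (μ := μ)
      (f := fun ω => Real.cosh ‖∑ i, c • Z i ω‖)
      (Filter.Eventually.of_forall fun ω => (Real.cosh_pos _).le)
      (integrable_cosh_norm_sum (Z := fun i ω => c • Z i ω) (fun i => (hm i).const_smul c) hcb Finset.univ) (Real.exp (2 * l) / 2)
    have hsub : {ω | 2 * b * √(n * l) < ‖∑ i, Z i ω‖} ⊆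
        {ω | Real.exp (2 * l) / 2 ≤ Real.cosh ‖∑ i, c • Z i ω‖} := by
      intro ω hω
      change 2 * b * √(n * l) < _ at hω
      change _ ≤ Real.cosh _
      have h2 : 2 * l ≤ ‖∑ i, c • Z i ω‖ := by
        rw [← Finset.smul_sum, norm_smul, Real.norm_of_nonneg hc0, ← e2]
        gcongr
      rw [Real.cosh_eq]
      have := Real.exp_le_exp.2 h2
      have := Real.exp_pos (-‖∑ i, c • Z i ω‖)
      linarith
    refine (measure_mono hsub).trans ?_
    rw [← ofReal_measureReal]
    refine ENNReal.ofReal_le_ofReal ?_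
    have h3 := hM.trans h
    have e3 : Real.exp (2 * l) = Real.exp l * Real.exp l := by rw [← Real.exp_add]; ring_nf
    rw [e3] at h3
    rw [Real.exp_neg, ← div_eq_mul_inv, le_div_iff₀ (Real.exp_pos l)]
    refine le_of_mul_le_mul_right ?_ (Real.exp_pos l)
    rw [e3]
    linarith

theorem integral_exp_le {V : Ω → ℝ} (hV : Measurable V) (h0 : ∫ ω, V ω ∂μ = 0)
    (hb : ∀ ω, |V ω| ≤ b) : ∫ ω, Real.exp (V ω) ∂μ ≤ Real.exp (b ^ 2) := by
  have hi : Integrable V μ := Integrable.of_bound hV.aestronglyMeasurable b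
    (Filter.Eventually.of_forall hb)
  have h1 : ∫ ω, Real.exp (V ω) ∂μ ≤ ∫ ω, (V ω + Real.exp (b ^ 2)) ∂μ := by
    refine integral_mono ?_ (hi.add (integrable_const _)) fun ω => ?_
    · refine Integrable.of_bound hV.exp.aestronglyMeasurable (Real.exp b)
        (Filter.Eventually.of_forall fun ω => ?_)
      rw [Real.norm_of_nonneg (Real.exp_pos _).le]
      exact Real.exp_le_exp.2 ((le_abs_self _).trans (hb ω))
    · refine (exp_le_add_exp_sq _).trans ?_
      have := sq_le_sq' (abs_le.1 (hb ω)).1 (abs_le.1 (hb ω)).2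
      gcongr
  rw [integral_add hi (integrable_const _), h0] at h1
  simpa using h1

theorem lintegral_exp_sum_pi_le [Fintype ι] {V : Ω → ℝ} (hV : Measurable V)
    (h0 : ∫ ω, V ω ∂μ = 0) (hb : ∀ ω, |V ω| ≤ b) :
    ∫⁻ s, ENNReal.ofReal (Real.exp (∑ i, V (s i))) ∂Measure.pi (fun _ : ι => μ) ≤
      ENNReal.ofReal (Real.exp (Fintype.card ι * b ^ 2)) := by
  have hms : Measurable fun s : ι → Ω => Real.exp (∑ i, V (s i)) :=
    (Finset.measurable_fun_sum _ fun i _ => hV.comp (measurable_pi_apply i)).exp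
  have hi : Integrable (fun s : ι → Ω => Real.exp (∑ i, V (s i)))
      (Measure.pi fun _ : ι => μ) := by
    refine Integrable.of_bound hms.aestronglyMeasurable (Real.exp (∑ _i : ι, b))
      (Filter.Eventually.of_forall fun s => ?_)
    rw [Real.norm_of_nonneg (Real.exp_pos _).le]
    exact Real.exp_le_exp.2 (Finset.sum_le_sum fun i _ => (le_abs_self _).trans (hb _))
  rw [← ofReal_integral_eq_lintegral_ofReal hi
    (Filter.Eventually.of_forall fun s => (Real.exp_pos _).le)]
  refine ENNReal.ofReal_le_ofReal ?_
  simp only [Real.exp_sum]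
  rw [integral_fintype_prod_eq_prod (fun _ : ι => fun ω => Real.exp (V ω)), Real.exp_nat_mul,
    Finset.prod_const, Finset.card_univ]
  exact pow_le_pow_left₀ (integral_nonneg fun ω => (Real.exp_pos _).le)
    (integral_exp_le hV h0 hb) _

end Concentration

/-! ### Freezing known quantities while integrating an independent sample. -/

section Freezing

variable {Ω Ω' β H : Type*} {𝒢 𝒢' : MeasurableSpace Ω} {mΩ : MeasurableSpace Ω} {mΩ' : MeasurableSpace Ω'}
  {mβ : MeasurableSpace β} {μ : Measure Ω} [IsProbabilityMeasure μ]

theorem lintegral_comp_of_indepFun {U : Ω → Ω'} {S : Ω → β} (hU : Measurable U)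
    (hS : Measurable S) (hind : IndepFun U S μ) {F : Ω' × β → ENNReal} (hF : Measurable F) :
    ∫⁻ ω, F (U ω, S ω) ∂μ = ∫⁻ ω, ∫⁻ s, F (U ω, s) ∂(μ.map S) ∂μ := by
  have := Measure.isProbabilityMeasure_map hU.aemeasurable (μ := μ)
  have := Measure.isProbabilityMeasure_map hS.aemeasurable (μ := μ)
  have h := (indepFun_iff_map_prod_eq_prod_map_map hU.aemeasurable hS.aemeasurable).1 hind
  rw [← lintegral_map hF (hU.prodMk hS), h, lintegral_prod _ hF.aemeasurable,
    lintegral_map hF.lintegral_prod_right' hU]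

theorem integral_comp_of_indepFun [NormedAddCommGroup H] [NormedSpace ℝ H] [MeasurableSpace H]
    [BorelSpace H] [SecondCountableTopology H] {U : Ω → Ω'} {S : Ω → β} (hU : Measurable U)
    (hS : Measurable S) (hind : IndepFun U S μ) {F : Ω' × β → H} (hF : Measurable F) {b : ℝ}
    (hb : ∀ p, ‖F p‖ ≤ b) :
    ∫ ω, F (U ω, S ω) ∂μ = ∫ ω, ∫ s, F (U ω, s) ∂(μ.map S) ∂μ := by
  have := Measure.isProbabilityMeasure_map hU.aemeasurable (μ := μ)
  have := Measure.isProbabilityMeasure_map hS.aemeasurable (μ := μ)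
  have h := (indepFun_iff_map_prod_eq_prod_map_map hU.aemeasurable hS.aemeasurable).1 hind
  have hi : Integrable F ((μ.map U).prod (μ.map S)) :=
    Integrable.of_bound hF.aestronglyMeasurable b (Filter.Eventually.of_forall hb)
  rw [← integral_map (f := F) (hU.prodMk hS).aemeasurable hF.aestronglyMeasurable, h,
    integral_prod _ hi, integral_map hU.aemeasurable
      hF.stronglyMeasurable.integral_prod_right'.aestronglyMeasurable]

theorem ae_of_indepFun {U : Ω → Ω'} {S : Ω → β} (hU : Measurable U) (hS : Measurable S)
    (hind : IndepFun U S μ) {A : Set (Ω' × β)} (hA : MeasurableSet A)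
    (h : ∀ u, ∀ᵐ s ∂(μ.map S), (u, s) ∈ A) : ∀ᵐ ω ∂μ, (U ω, S ω) ∈ A := by
  have h1 := lintegral_comp_of_indepFun hU hS hind
    (measurable_one.indicator hA.compl : Measurable (Aᶜ.indicator (1 : Ω' × β → ENNReal)))
  have h2 : ∀ u, ∫⁻ s, Aᶜ.indicator (1 : Ω' × β → ENNReal) (u, s) ∂(μ.map S) = 0 := fun u => by
    refine (lintegral_eq_zero_iff ((measurable_one.indicator hA.compl).comp
      measurable_prodMk_left)).2 ?_
    filter_upwards [h u] with s hs
    simp [hs]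
  simp only [h2, lintegral_zero] at h1
  have h3 := (lintegral_eq_zero_iff
    ((measurable_one.indicator hA.compl).comp (hU.prodMk hS))).1 h1
  filter_upwards [h3] with ω hω
  by_contra hn
  simp [hn] at hω

/-- Conditional expectation of a function of a known and an independent variable. -/
theorem condExp_comp_of_indep [NormedAddCommGroup H] [NormedSpace ℝ H] [MeasurableSpace H]
    [BorelSpace H] [SecondCountableTopology H] [CompleteSpace H]
    (h𝒢 : 𝒢 ≤ mΩ) {Y : Ω → Ω'} {S : Ω → β} (hY : Measurable[𝒢] Y) (hS : Measurable S)
    (hind : Indep (MeasurableSpace.comap S mβ) 𝒢 μ) {F : Ω' × β → H} (hF : Measurable F) {b : ℝ}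
    (hb : ∀ p, ‖F p‖ ≤ b) :
    μ[fun ω => F (Y ω, S ω) | 𝒢] =ᵐ[μ] fun ω => ∫ s, F (Y ω, s) ∂(μ.map S) := by
  have := Measure.isProbabilityMeasure_map hS.aemeasurable (μ := μ)
  have hY' : Measurable Y := hY.mono h𝒢 le_rfl
  have hm : StronglyMeasurable fun u => ∫ s, F (u, s) ∂(μ.map S) :=
    hF.stronglyMeasurable.integral_prod_right'
  have hbi : ∀ u, ‖∫ s, F (u, s) ∂(μ.map S)‖ ≤ b := fun u => by
    simpa using norm_integral_le_of_norm_le_const (μ := μ.map S)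
      (Filter.Eventually.of_forall fun s => hb (u, s))
  have hig : Integrable (fun ω => ∫ s, F (Y ω, s) ∂(μ.map S)) μ :=
    Integrable.of_bound (hm.measurable.comp hY').aestronglyMeasurable b
      (Filter.Eventually.of_forall fun ω => hbi _)
  refine (ae_eq_condExp_of_forall_setIntegral_eq h𝒢
    (Integrable.of_bound (hF.comp (hY'.prodMk hS)).aestronglyMeasurable b
      (Filter.Eventually.of_forall fun ω => hb _)) (fun A _ _ => hig.integrableOn) (fun A hA _ => ?_)
    (hm.measurable.comp hY).stronglyMeasurable.aestronglyMeasurable).symm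
  have hA' := h𝒢 A hA
  have hχ : Measurable[𝒢] (A.indicator (1 : Ω → ℝ)) := by
    exact (measurable_const (a := (1 : ℝ))).indicator hA
  have hUG : Measurable[𝒢] fun ω => (A.indicator (1 : Ω → ℝ) ω, Y ω) := by
    exact Measurable.prodMk hχ hY
  have hUind : IndepFun (fun ω => (A.indicator (1 : Ω → ℝ) ω, Y ω)) S μ := by
    rw [IndepFun_iff_Indep]
    exact (indep_of_indep_of_le_right hind hUG.comap_le).symm
  -- The indicator of the test set joins `Y` as a frozen variable. Clamping it to `[-1, 1]` keeps
  -- the integrand bounded everywhere and does not change the values `0` and `1`.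
  have hclamp : Measurable fun p : (ℝ × Ω') × β => (max (-1) (min 1 p.1.1)) • F (p.1.2, p.2) :=
    (measurable_const.max (measurable_const.min (measurable_fst.comp measurable_fst))).smul
      (hF.comp ((measurable_snd.comp measurable_fst).prodMk measurable_snd))
  have key := integral_comp_of_indepFun (hUG.mono h𝒢 le_rfl) hS hUind hclamp (b := b) (fun p => by
    rw [norm_smul]
    have h1 : ‖max (-1) (min 1 p.1.1)‖ ≤ 1 := abs_le.2
      ⟨le_max_left _ _, max_le (by norm_num) (min_le_left _ _)⟩
    exact (mul_le_of_le_one_left (norm_nonneg _) h1).trans (hb _))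
  rw [← integral_indicator hA', ← integral_indicator hA']
  refine (integral_congr_ae (Filter.Eventually.of_forall fun ω => ?_)).trans
    (key.symm.trans (integral_congr_ae (Filter.Eventually.of_forall fun ω => ?_)))
  · by_cases hω : ω ∈ A <;> simp [hω]
  · by_cases hω : ω ∈ A <;> simp [hω]

theorem measurable_comp_prodMk {γ : Type*} [MeasurableSpace γ]
    (h : 𝒢 ≤ 𝒢') {S : Ω → β} (hS : Measurable[𝒢'] S) {F : Ω × β → γ}
    (hF : Measurable[MeasurableSpace.prod 𝒢 mβ] F) : Measurable[𝒢'] fun ω => F (ω, S ω) := by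
  have h1 : @Measurable Ω (Ω × β) 𝒢' (MeasurableSpace.prod 𝒢 mβ) fun ω => (ω, S ω) := by
    exact Measurable.prodMk (measurable_id'' h) hS
  exact hF.comp h1

theorem lintegral_comp_of_indep (h𝒢 : 𝒢 ≤ mΩ) {S : Ω → β}
    (hS : Measurable S) (hind : Indep (MeasurableSpace.comap S mβ) 𝒢 μ) {F : Ω × β → ENNReal}
    (hF : Measurable[MeasurableSpace.prod 𝒢 mβ] F) :
    ∫⁻ ω, F (ω, S ω) ∂μ = ∫⁻ ω, ∫⁻ s, F (ω, s) ∂(μ.map S) ∂μ := by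
  -- The frozen variable is the identity from `(Ω, mΩ)` to `(Ω, 𝒢)`, which carries all information
  -- in `𝒢`.
  refine @lintegral_comp_of_indepFun Ω Ω β mΩ 𝒢 mβ μ _ id S (measurable_id'' h𝒢) hS ?_ F hF
  rw [@IndepFun_iff_Indep Ω Ω β mΩ 𝒢 mβ id S μ, MeasurableSpace.comap_id]
  exact hind.symm

end Freezing

/-! ### Conditional Hoeffding and Azuma inequalities for fresh samples. -/

section FreshSample

variable {Ω : Type*} {𝒢 𝒢' : MeasurableSpace Ω} {mΩ : MeasurableSpace Ω} {μ : Measure Ω} {d m : ℕ} {P : Measure (E d)} {σ : Fin m → Ω → E d}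

theorem IsFreshSample.mono (h : IsFreshSample 𝒢 μ P σ) (h' : 𝒢' ≤ 𝒢) :
    IsFreshSample 𝒢' μ P σ :=
  ⟨h.measurable, h.law, h.iIndep, indep_of_indep_of_le_right h.indep h'⟩

theorem IsFreshSample.measurable_pi (h : IsFreshSample 𝒢 μ P σ) :
    Measurable fun ω j => σ j ω := measurable_pi_lambda _ h.measurable

theorem IsFreshSample.indep_pi (h : IsFreshSample 𝒢 μ P σ) :
    Indep (MeasurableSpace.comap (fun ω j => σ j ω) MeasurableSpace.pi) 𝒢 μ := by
  refine indep_of_indep_of_le_left h.indep ?_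
  rw [MeasurableSpace.pi, MeasurableSpace.comap_iSup]
  refine iSup_mono fun j => ?_
  rw [MeasurableSpace.comap_comp]
  rfl

theorem IsFreshSample.indep_apply (h : IsFreshSample 𝒢 μ P σ) (j : Fin m) :
    Indep (MeasurableSpace.comap (σ j) inferInstance) 𝒢 μ :=
  indep_of_indep_of_le_left h.indep
    (le_iSup (fun j => MeasurableSpace.comap (σ j) inferInstance) j)

theorem IsFreshSample.map_pi [IsProbabilityMeasure μ] (h : IsFreshSample 𝒢 μ P σ) :
    μ.map (fun ω j => σ j ω) = Measure.pi fun _ => P := by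
  rw [(iIndepFun_iff_map_fun_eq_pi_map fun j => (h.measurable j).aemeasurable).1 h.iIndep]
  simp only [h.law]

theorem measurable_sum_pi {H : Type*} [AddCommMonoid H] [MeasurableSpace H] [MeasurableAdd₂ H]
    {V : Ω → E d → H}
    (hV : Measurable[MeasurableSpace.prod 𝒢 inferInstance] fun p : Ω × E d => V p.1 p.2) :
    Measurable[MeasurableSpace.prod 𝒢 MeasurableSpace.pi]
      fun p : Ω × (Fin m → E d) => ∑ j, V p.1 (p.2 j) := by
  refine Finset.measurable_fun_sum _ fun j _ => ?_
  have h2 : @Measurable (Ω × (Fin m → E d)) (Ω × E d) (MeasurableSpace.prod 𝒢 MeasurableSpace.pi)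
      (MeasurableSpace.prod 𝒢 inferInstance) fun p => (p.1, p.2 j) := by
    refine Measurable.prodMk ?_ ?_
    · exact @measurable_fst _ _ 𝒢 _
    · exact (measurable_pi_apply j).comp (@measurable_snd _ _ 𝒢 _)
  exact hV.comp h2

variable [IsProbabilityMeasure μ] [IsProbabilityMeasure P]

/-- Hoeffding's inequality, conditionally on the information available before sampling. -/
theorem measure_norm_sum_fresh_gt_le {H : Type*} [NormedAddCommGroup H] [InnerProductSpace ℝ H]
    [MeasurableSpace H] [BorelSpace H] [SecondCountableTopology H] [CompleteSpace H]
    (h𝒢 : 𝒢 ≤ mΩ) (hσ : IsFreshSample 𝒢 μ P σ) {V : Ω → E d → H}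
    (hV : Measurable[MeasurableSpace.prod 𝒢 inferInstance] fun p : Ω × E d => V p.1 p.2)
    (h0 : ∀ ω, ∫ s, V ω s ∂P = 0) {b : ℝ} (hb0 : 0 ≤ b) (hb : ∀ ω s, ‖V ω s‖ ≤ b)
    {l : ℝ} (hl : 0 ≤ l) :
    μ {ω | 2 * b * √(m * l) < ‖∑ j, V ω (σ j ω)‖} ≤ ENNReal.ofReal (2 * Real.exp (-l)) := by
  have hVω : ∀ ω, Measurable (V ω) := fun ω =>
    hV.comp (@measurable_prodMk_left _ _ 𝒢 _ ω)
  have hsum := measurable_sum_pi (m := m) hV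
  have hA : MeasurableSet[MeasurableSpace.prod 𝒢 MeasurableSpace.pi]
      {p : Ω × (Fin m → E d) | 2 * b * √(m * l) < ‖∑ j, V p.1 (p.2 j)‖} := by
    have := measurable_norm.comp hsum
    exact measurableSet_lt measurable_const this
  set A := {p : Ω × (Fin m → E d) | 2 * b * √(m * l) < ‖∑ j, V p.1 (p.2 j)‖}
  have hF : Measurable[MeasurableSpace.prod 𝒢 MeasurableSpace.pi]
      (A.indicator (1 : Ω × (Fin m → E d) → ENNReal)) := by
    exact (measurable_const (a := (1 : ENNReal))).indicator hA
  have key := lintegral_comp_of_indep h𝒢 hσ.measurable_pi hσ.indep_pi hF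
  rw [hσ.map_pi] at key
  have e1 : ∫⁻ ω, A.indicator (1 : Ω × (Fin m → E d) → ENNReal) (ω, fun j => σ j ω) ∂μ =
      μ {ω | 2 * b * √(m * l) < ‖∑ j, V ω (σ j ω)‖} := by
    rw [← lintegral_indicator_one]
    · rfl
    · have h := measurable_comp_prodMk h𝒢 hσ.measurable_pi hsum
      exact measurableSet_lt measurable_const h.norm
  rw [← e1, key]
  have h2 : ∀ ω, ∫⁻ s, A.indicator (1 : Ω × (Fin m → E d) → ENNReal) (ω, s)
      ∂(Measure.pi fun _ => P) ≤ ENNReal.ofReal (2 * Real.exp (-l)) := fun ω => by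
    -- For frozen `ω` the summands are independent and centred under the product measure.
    have h3 := measure_norm_sum_gt_le (μ := Measure.pi fun _ : Fin m => P)
      (Z := fun j s => V ω (s j)) (fun j => (hVω ω).comp (measurable_pi_apply j))
      (iIndepFun_pi fun j => (hVω ω).aemeasurable)
      (fun j => by
        rw [← h0 ω]
        exact integral_comp_eval (μ := fun _ : Fin m => P) (hVω ω).aestronglyMeasurable)
      hb0 (fun j s => hb ω _) hl
    rw [Fintype.card_fin] at h3
    refine le_trans (le_of_eq ?_) h3
    rw [← lintegral_indicator_one]
    · rfl
    · exact measurableSet_lt measurable_const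
        (Finset.measurable_fun_sum _ fun j _ => (hVω ω).comp (measurable_pi_apply j)).norm
  calc _ ≤ ∫⁻ _ω, ENNReal.ofReal (2 * Real.exp (-l)) ∂μ := lintegral_mono h2
    _ = _ := by simp

variable {ℱ : Filtration ℕ mΩ} {τ : ℕ → Fin m → Ω → E d} {T : ℕ}

theorem lintegral_exp_sum_fresh_le (hτ : ∀ t < T, IsFreshSample (ℱ t) μ P (τ t))
    (hτm : ∀ t < T, ∀ j, Measurable[ℱ (t + 1)] (τ t j)) {V : ℕ → Ω → E d → ℝ}
    (hV : ∀ t < T, Measurable[MeasurableSpace.prod (ℱ t) inferInstance]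
      fun p : Ω × E d => V t p.1 p.2)
    (h0 : ∀ t < T, ∀ ω, ∫ s, V t ω s ∂P = 0) {b : ℝ} (hb : ∀ t < T, ∀ ω s, |V t ω s| ≤ b) :
    ∫⁻ ω, ENNReal.ofReal (Real.exp (∑ t ∈ Finset.range T, ∑ j, V t ω (τ t j ω))) ∂μ ≤
      ENNReal.ofReal (Real.exp (m * b ^ 2)) ^ T := by
  suffices h : ∀ n ≤ T,
      ∫⁻ ω, ENNReal.ofReal (Real.exp (∑ t ∈ Finset.range n, ∑ j, V t ω (τ t j ω))) ∂μ ≤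
        ENNReal.ofReal (Real.exp (m * b ^ 2)) ^ n from h T le_rfl
  intro n
  induction n with
  | zero => simp
  | succ n ih =>
    intro hn
    have hsum : ∀ t < T, Measurable[MeasurableSpace.prod (ℱ t) MeasurableSpace.pi]
        fun p : Ω × (Fin m → E d) => ∑ j, V t p.1 (p.2 j) := fun t ht =>
      measurable_sum_pi (hV t ht)
    have hpast : Measurable[ℱ n] fun ω => ENNReal.ofReal
        (Real.exp (∑ t ∈ Finset.range n, ∑ j, V t ω (τ t j ω))) := by
      refine ENNReal.measurable_ofReal.comp (Real.measurable_exp.comp ?_)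
      refine Finset.measurable_fun_sum _ fun t ht => ?_
      have ht' := Finset.mem_range.1 ht
      have hτ' : Measurable[ℱ n] fun ω j => τ t j ω := by
        refine @measurable_pi_lambda _ _ _ (ℱ n) _ _ fun j => ?_
        exact (hτm t (by omega) j).mono (ℱ.mono ht') le_rfl
      exact measurable_comp_prodMk (ℱ.mono ht'.le) hτ' (hsum t (by omega))
    -- Rounds before `n` form a factor known to `ℱ n`; freezing it leaves only the samples of round
    -- `n`, which cost one factor `exp (m * b²)`.
    have hF : Measurable[MeasurableSpace.prod (ℱ n) MeasurableSpace.pi]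
        fun p : Ω × (Fin m → E d) => ENNReal.ofReal
          (Real.exp (∑ t ∈ Finset.range n, ∑ j, V t p.1 (τ t j p.1))) *
          ENNReal.ofReal (Real.exp (∑ j, V n p.1 (p.2 j))) := by
      exact (hpast.comp (@measurable_fst _ _ (ℱ n) _)).mul
        (ENNReal.measurable_ofReal.comp (Real.measurable_exp.comp (hsum n hn)))
    have key := lintegral_comp_of_indep (ℱ.le n) (hτ n hn).measurable_pi (hτ n hn).indep_pi hF
    rw [(hτ n hn).map_pi] at key
    have hVω : ∀ ω, Measurable (V n ω) := fun ω =>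
      (hV n hn).comp (@measurable_prodMk_left _ _ (ℱ n) _ ω)
    calc ∫⁻ ω, ENNReal.ofReal (Real.exp (∑ t ∈ Finset.range (n + 1), ∑ j, V t ω (τ t j ω))) ∂μ
        = ∫⁻ ω, ENNReal.ofReal (Real.exp (∑ t ∈ Finset.range n, ∑ j, V t ω (τ t j ω))) *
            ENNReal.ofReal (Real.exp (∑ j, V n ω (τ n j ω))) ∂μ := by
          simp only [Finset.sum_range_succ, Real.exp_add,
            ENNReal.ofReal_mul (Real.exp_pos _).le]
      _ = _ := key
      _ ≤ ∫⁻ ω, ENNReal.ofReal (Real.exp (∑ t ∈ Finset.range n, ∑ j, V t ω (τ t j ω))) *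
            ENNReal.ofReal (Real.exp (m * b ^ 2)) ∂μ := by
          refine lintegral_mono fun ω => ?_
          dsimp only
          rw [lintegral_const_mul' _ _ ENNReal.ofReal_ne_top]
          gcongr
          simpa using lintegral_exp_sum_pi_le (ι := Fin m) (hVω ω) (h0 n hn ω) (hb n hn ω)
      _ ≤ _ := by
          rw [lintegral_mul_const' _ _ ENNReal.ofReal_ne_top,
            pow_succ (ENNReal.ofReal (Real.exp (m * b ^ 2)))]
          gcongr
          exact ih (by omega)

/-- The Azuma–Hoeffding inequality for sums over rounds of fresh samples. -/
theorem measure_sum_fresh_gt_le (hτ : ∀ t < T, IsFreshSample (ℱ t) μ P (τ t))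
    (hτm : ∀ t < T, ∀ j, Measurable[ℱ (t + 1)] (τ t j)) {V : ℕ → Ω → E d → ℝ}
    (hV : ∀ t < T, Measurable[MeasurableSpace.prod (ℱ t) inferInstance]
      fun p : Ω × E d => V t p.1 p.2)
    (h0 : ∀ t < T, ∀ ω, ∫ s, V t ω s ∂P = 0) {b : ℝ} (hb0 : 0 ≤ b)
    (hb : ∀ t < T, ∀ ω s, |V t ω s| ≤ b) {l : ℝ} (hl : 0 ≤ l) :
    μ {ω | 2 * b * √(T * m * l) < ∑ t ∈ Finset.range T, ∑ j, V t ω (τ t j ω)} ≤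
      ENNReal.ofReal (Real.exp (-l)) := by
  set n : ℝ := (T * m : ℝ) with hn
  have hn0 : 0 ≤ n := by positivity
  rcases (mul_nonneg hn0 hb0).eq_or_lt with hz | hz
  · have he : {ω | 2 * b * √(n * l) < ∑ t ∈ Finset.range T, ∑ j, V t ω (τ t j ω)} = ∅ := by
      refine Set.eq_empty_of_forall_notMem fun ω hω => ?_
      have h1 : ∑ t ∈ Finset.range T, ∑ j, V t ω (τ t j ω) ≤
          ∑ _t ∈ Finset.range T, ∑ _j : Fin m, b :=
        Finset.sum_le_sum fun t ht => Finset.sum_le_sum fun j _ =>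
          (le_abs_self _).trans (hb t (Finset.mem_range.1 ht) ω _)
      simp only [Finset.sum_const, Finset.card_univ, Fintype.card_fin, Finset.card_range,
        nsmul_eq_mul, ← mul_assoc] at h1
      rw [← hn, ← hz] at h1
      exact absurd (lt_of_le_of_lt (by positivity) hω) (not_lt.2 h1)
    rw [he]
    simp
  · have hb' : 0 < b := pos_of_mul_pos_right hz hn0
    have hn' : 0 < n := pos_of_mul_pos_left hz hb0
    set c : ℝ := √(l / n) / b with hc
    have hc0 : 0 ≤ c := by positivity
    have h := lintegral_exp_sum_fresh_le (V := fun t ω s => c * V t ω s) (b := c * b) hτ hτm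
      (fun t ht => (hV t ht).const_mul c)
      (fun t ht ω => by rw [integral_const_mul, h0 t ht, mul_zero])
      (fun t ht ω s => by
        rw [abs_mul, abs_of_nonneg hc0]
        exact mul_le_mul_of_nonneg_left (hb t ht ω s) hc0)
    rw [← ENNReal.ofReal_pow (Real.exp_pos _).le, ← Real.exp_nat_mul, ← mul_assoc, ← hn] at h
    have e1 : n * (c * b) ^ 2 = l := by
      rw [hc, div_mul_cancel₀ _ hb'.ne', Real.sq_sqrt (by positivity)]
      field_simp
    rw [e1] at h
    have e2 : c * (2 * b * √(n * l)) = 2 * l := by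
      have : √(l / n) * √(n * l) = l := by
        rw [← Real.sqrt_mul (by positivity)]
        have : l / n * (n * l) = l ^ 2 := by field_simp
        rw [this, Real.sqrt_sq hl]
      rw [hc]
      calc √(l / n) / b * (2 * b * √(n * l)) = 2 * (√(l / n) * √(n * l)) := by field_simp
        _ = 2 * l := by rw [this]
    have hM := meas_ge_le_lintegral_div (μ := μ) (f := fun ω => ENNReal.ofReal
      (Real.exp (∑ t ∈ Finset.range T, ∑ j, c * V t ω (τ t j ω))))
      (ε := ENNReal.ofReal (Real.exp (2 * l))) (by
        refine (ENNReal.measurable_ofReal.comp (Real.measurable_exp.comp ?_)).aemeasurable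
        refine Finset.measurable_fun_sum _ fun t ht => ?_
        have ht' := Finset.mem_range.1 ht
        exact measurable_comp_prodMk (ℱ.le t) (hτ t ht').measurable_pi
          (measurable_sum_pi (V := fun ω s => c * V t ω s) ((hV t ht').const_mul c)))
      (by simpa using Real.exp_pos _) ENNReal.ofReal_ne_top
    refine (measure_mono fun ω hω => ?_).trans (hM.trans ((ENNReal.div_le_div_right h _).trans ?_))
    · change 2 * b * √(n * l) < _ at hω
      change ENNReal.ofReal _ ≤ ENNReal.ofReal _
      refine ENNReal.ofReal_le_ofReal (Real.exp_le_exp.2 ?_)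
      simp only [← Finset.mul_sum]
      rw [← e2]
      gcongr
    · rw [← ENNReal.ofReal_div_of_pos (Real.exp_pos _), ← Real.exp_sub]
      apply le_of_eq
      ring_nf

end FreshSample

/-! ### Convexity and Hölder estimates along a single path. -/

section Pathwise

variable {d : ℕ} {N : Seminorm ℝ (E d)} {X : Set (E d)}

theorem sub_le_inner_gradient {F : E d → ℝ} (hF : ConvexOn ℝ X F) {x y v : E d} (hx : x ∈ X)
    (hy : y ∈ X) (hv : HasGradientWithinAt F v X x) : F x - F y ≤ inner ℝ v (x - y) := by
  have hmaps : Set.MapsTo (AffineMap.lineMap x y : ℝ →ᵃ[ℝ] E d) (Set.Icc 0 1) X :=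
    fun t ht => hF.1.lineMap_mem hx hy ht
  have hconv : ConvexOn ℝ (Set.Icc (0 : ℝ) 1) (F ∘ (AffineMap.lineMap x y : ℝ →ᵃ[ℝ] E d)) :=
    (hF.comp_affineMap _).subset hmaps (convex_Icc 0 1)
  have h1 : HasDerivWithinAt (AffineMap.lineMap x y : ℝ →ᵃ[ℝ] E d) (y - x) (Set.Icc 0 1) 0 :=
    AffineMap.hasDerivWithinAt_lineMap
  have h2 := hv.hasFDerivWithinAt
  rw [← AffineMap.lineMap_apply_zero (k := ℝ) x y] at h2
  have h3 := h2.comp_hasDerivWithinAt 0 h1 hmaps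
  have h4 := hconv.le_slope_of_hasDerivWithinAt (Set.left_mem_Icc.2 zero_le_one)
    (Set.right_mem_Icc.2 zero_le_one) zero_lt_one h3
  simp only [slope_def_field, Function.comp_apply, AffineMap.lineMap_apply_zero,
    AffineMap.lineMap_apply_one, sub_zero, div_one, InnerProductSpace.toDual_apply_apply] at h4
  rw [← neg_sub y x, inner_neg_right]
  linarith

theorem sum_loss_sub_le (hN : ∀ x, N x = 0 → x = 0) {F : ℕ → E d → ℝ} {v : ℕ → E d → E d}
    {x z : ℕ → E d} {y : E d} {T : ℕ} {L α : ℝ} (hα : 0 ≤ α)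
    (hF : ∀ t < T, ConvexOn ℝ X (F t)) (hx : ∀ t < T, x t ∈ X) (hz : ∀ t < T, z t ∈ X)
    (hy : y ∈ X) (hv : ∀ t < T, ∀ x ∈ X, HasGradientWithinAt (F t) (v t x) X x)
    (hL : ∀ t < T, ∀ x ∈ X, ∀ y ∈ X, dualNorm N (v t x - v t y) ≤ L * N (x - y) ^ α) :
    ∑ t ∈ Finset.range T, (F t (x t) - F t y) ≤
      ∑ t ∈ Finset.range T, inner ℝ (v t (x t)) (z t - y)
        + ∑ t ∈ Finset.range T, inner ℝ (v t (z t)) (x t - z t)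
        + ∑ t ∈ Finset.range T, L * N (x t - z t) ^ (1 + α) := by
  rw [← Finset.sum_add_distrib, ← Finset.sum_add_distrib]
  refine Finset.sum_le_sum fun t ht => ?_
  have ht' := Finset.mem_range.1 ht
  have h1 := sub_le_inner_gradient (hF t ht') (hx t ht') hy (hv t ht' _ (hx t ht'))
  have h2 := inner_le_dualNorm_mul hN (v t (x t) - v t (z t)) (x t - z t)
  have h3 := mul_le_mul_of_nonneg_right (hL t ht' _ (hx t ht') _ (hz t ht'))
    (apply_nonneg N (x t - z t))
  rw [mul_assoc, ← Real.rpow_add_one' (apply_nonneg N _) (by positivity), add_comm α] at h3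
  rw [inner_sub_left] at h2
  have h4 : (inner ℝ (v t (x t)) (x t - y) : ℝ) =
      inner ℝ (v t (x t)) (z t - y) + inner ℝ (v t (x t)) (x t - z t) := by
    rw [← inner_add_right]
    congr 1
    abel
  linarith

/-- No sign of `L` is assumed. A negative `L` would make a dual norm negative unless all points of
`X` coincide. -/
theorem diameter_eq_zero_of_neg {v : E d → E d} {L α : ℝ} (hN : ∀ x, N x = 0 → x = 0)
    (hL0 : L < 0) (hL : ∀ x ∈ X, ∀ y ∈ X, dualNorm N (v x - v y) ≤ L * N (x - y) ^ α) :
    diameter N X = 0 := by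
  refine le_antisymm (Real.iSup_le (fun p => ?_) le_rfl) (diameter_nonneg N X)
  have h1 := hL _ p.1.2 _ p.2.2
  have h2 := dualNorm_nonneg hN (v p.1 - v p.2)
  by_contra h
  have h3 := Real.rpow_pos_of_pos (not_le.1 h) α
  nlinarith

end Pathwise

/-! ### Almost sure uniqueness and conditional means of the predictions. -/

section Predictions

variable {Ω : Type*} {𝒢 : MeasurableSpace Ω} {mΩ : MeasurableSpace Ω} {μ : Measure Ω}
  [IsProbabilityMeasure μ] {d m : ℕ} {X : Set (E d)} {P : Measure (E d)}
  {σ z : Fin m → Ω → E d} {Y : Ω → E d}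

theorem ae_eq_selection (hne : X.Nonempty) (hc : IsCompact X) (hP : P ≪ volume)
    (h𝒢 : 𝒢 ≤ mΩ) (hσ : IsFreshSample 𝒢 μ P σ) (hY : Measurable[𝒢] Y)
    (hz : ∀ j ω, IsLinMin X (Y ω - σ j ω) (z j ω)) (x₀ : E d) :
    ∀ᵐ ω ∂μ, ∀ j, z j ω = selection X x₀ (Y ω - σ j ω) := by
  rw [ae_all_iff]
  intro j
  have hind : IndepFun Y (σ j) μ := by
    rw [IndepFun_iff_Indep]
    exact (indep_of_indep_of_le_right (hσ.indep_apply j) hY.comap_le).symm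
  have h := ae_of_indepFun (hY.mono h𝒢 le_rfl) (hσ.measurable j) hind
    (A := {p : E d × E d | DifferentiableAt ℝ (linMin X) (p.1 - p.2)})
    ((measurableSet_of_differentiableAt ℝ (linMin X)).preimage
      (measurable_fst.sub measurable_snd))
    (fun u => by
      rw [hσ.law j]
      exact ae_differentiableAt_sub hne hc hP u)
  filter_upwards [h] with ω hω
  exact (hz j ω).eq_selection hne hc hω x₀

/-- Serves both conditional means of the theorem: `Y` is the accumulated gradient with the guess
added, or without it. -/
theorem condExp_average_eq [IsProbabilityMeasure P] (hne : X.Nonempty) (hc : IsCompact X)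
    (hP : P ≪ volume) (hm : 0 < m) (h𝒢 : 𝒢 ≤ mΩ) (hσ : IsFreshSample 𝒢 μ P σ)
    (hY : Measurable[𝒢] Y) (hz : ∀ j ω, IsLinMin X (Y ω - σ j ω) (z j ω)) :
    μ[fun ω => (m : ℝ)⁻¹ • ∑ j, z j ω | 𝒢] =ᵐ[μ] fun ω => gradPhi X P (Y ω) := by
  obtain ⟨x₀, hx₀⟩ := id hne
  obtain ⟨R, hR⟩ := exists_norm_bound hc
  have hsel := measurable_selection X x₀
  have hF : Measurable fun p : E d × (Fin m → E d) =>
      (m : ℝ)⁻¹ • ∑ j, selection X x₀ (p.1 - p.2 j) :=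
    (Finset.measurable_fun_sum _ fun j _ => hsel.comp (measurable_fst.sub
      ((measurable_pi_apply j).comp measurable_snd) :
        Measurable fun p : E d × (Fin m → E d) => p.1 - p.2 j)).fun_const_smul _
  have hm' : (m : ℝ) ≠ 0 := Nat.cast_ne_zero.2 hm.ne'
  have h1 := condExp_comp_of_indep (μ := μ) h𝒢 hY hσ.measurable_pi hσ.indep_pi hF (b := R)
    (fun p => by
      rw [norm_smul, norm_inv, Real.norm_natCast, inv_mul_le_iff₀ (by positivity)]
      have := norm_sum_le_of_le Finset.univ
        fun j _ => hR _ (selection_mem hne hc hx₀ (p.1 - p.2 j))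
      simpa using this)
  have h2 : (fun ω => (m : ℝ)⁻¹ • ∑ j, z j ω) =ᵐ[μ]
      fun ω => (m : ℝ)⁻¹ • ∑ j, selection X x₀ (Y ω - σ j ω) := by
    filter_upwards [ae_eq_selection hne hc hP h𝒢 hσ hY hz x₀] with ω hω
    simp only [hω]
  refine (condExp_congr_ae h2).trans (h1.trans (Filter.Eventually.of_forall fun ω => ?_))
  dsimp only
  have h3 : ∀ j : Fin m, ∫ s : Fin m → E d, selection X x₀ (Y ω - s j) ∂(Measure.pi fun _ => P) =
      gradPhi X P (Y ω) := fun j => by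
    rw [gradPhi_eq_integral_selection hne hc hP x₀]
    exact integral_comp_eval (μ := fun _ : Fin m => P) (f := fun s => selection X x₀ (Y ω - s))
      (hsel.comp (measurable_const.sub measurable_id)).aestronglyMeasurable
  rw [hσ.map_pi, integral_smul, integral_finsetSum]
  · simp only [h3, Finset.sum_const, Finset.card_univ, Fintype.card_fin]
    rw [← Nat.cast_smul_eq_nsmul ℝ, smul_smul, inv_mul_cancel₀ hm', one_smul]
  · intro j _
    exact integrable_comp_eval (μ := fun _ : Fin m => P) (i := j)
      (f := fun s => selection X x₀ (Y ω - s)) (integrable_selection hne hc hx₀ (Y ω))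

end Predictions

/-! ### Measurability of the quantities produced by a run. -/

section Run

variable {Ω : Type*} {mΩ : MeasurableSpace Ω} {μ : Measure Ω} {ℱ : Filtration ℕ mΩ} {d m T : ℕ}
  {X : Set (E d)} {P : Measure (E d)} {f : ℕ → Ω → E d → ℝ} {gradf : ℕ → Ω → E d → E d}
  {g : ℕ → Ω → E d} {σ xs : ℕ → Fin m → Ω → E d} {t : ℕ}

theorem average_mem {d m : ℕ} {X : Set (E d)} (hconv : Convex ℝ X) (hm : 0 < m)
    {z : Fin m → E d} (hz : ∀ j, z j ∈ X) : (m : ℝ)⁻¹ • ∑ j, z j ∈ X := by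
  have hm' : (m : ℝ) ≠ 0 := Nat.cast_ne_zero.2 hm.ne'
  rw [Finset.smul_sum]
  refine hconv.sum_mem (fun _ _ => by positivity) ?_ fun j _ => hz j
  simp [hm']

theorem IsRun.average_mem (h : IsRun μ ℱ X P T f gradf g σ xs) (hconv : Convex ℝ X) (hm : 0 < m)
    (ht : t < T) (ω : Ω) : average xs t ω ∈ X :=
  OFTPL.average_mem hconv hm fun j => (h.point_min t ht j ω).1

theorem IsRun.measurable_average (h : IsRun μ ℱ X P T f gradf g σ xs) (ht : t < T) :
    Measurable[ℱ (t + 1)] (average xs t) :=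
  (Finset.measurable_fun_sum _ fun j _ => h.point_measurable t ht j).fun_const_smul _

theorem IsRun.measurable_gradAt (h : IsRun μ ℱ X P T f gradf g σ xs) (hconv : Convex ℝ X)
    (hm : 0 < m) (ht : t < T) : Measurable[ℱ (t + 1)] (gradAt gradf (average xs) t) :=
  measurable_comp_prodMk (S := fun ω => (⟨average xs t ω, h.average_mem hconv hm ht ω⟩ : X))
    (ℱ.mono t.le_succ) ((h.measurable_average ht).subtype_mk) (h.grad_measurable t ht)

theorem IsRun.past_le (h : IsRun μ ℱ X P T f gradf g σ xs) (hconv : Convex ℝ X)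
    (hm : 0 < m) (ht : t < T) : past X f gradf (average xs) t ≤ ℱ t := by
  refine iSup_le fun i => ?_
  have hi : (i : ℕ) < T := i.2.trans ht
  refine sup_le (sup_le (iSup_le fun y => sup_le ?_ ?_) ?_) ?_
  · exact ((h.loss_measurable i hi y y.2).mono (ℱ.mono i.2.le) le_rfl).comap_le
  · have h1 := (h.grad_measurable i hi).comp
      (@measurable_prodMk_right _ _ (ℱ i) _ y)
    exact (h1.mono (ℱ.mono i.2.le) le_rfl).comap_le
  · exact ((h.measurable_average hi).mono (ℱ.mono i.2) le_rfl).comap_le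
  · exact ((h.measurable_gradAt hconv hm hi).mono (ℱ.mono i.2) le_rfl).comap_le

theorem measurable_cumGrad_past (x : ℕ → Ω → E d) (t : ℕ) :
    Measurable[past X f gradf x t] (cumGrad gradf x t) := by
  refine Finset.measurable_fun_sum _ fun i hi => ?_
  refine (comap_measurable (gradAt gradf x i)).mono ?_ le_rfl
  exact le_trans le_sup_right (le_iSup (fun i : Fin t =>
    (⨆ y : X, MeasurableSpace.comap (fun ω => f i ω y) inferInstance
      ⊔ MeasurableSpace.comap (fun ω => gradf i ω y) inferInstance)
    ⊔ MeasurableSpace.comap (x i) inferInstance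
    ⊔ MeasurableSpace.comap (gradAt gradf x i) inferInstance) ⟨i, Finset.mem_range.1 hi⟩)

theorem measurable_cumGrad_add_guess (x : ℕ → Ω → E d) (t : ℕ) :
    Measurable[pastWithGuess X f gradf g x t] fun ω => cumGrad gradf x t ω + g t ω :=
  ((measurable_cumGrad_past x t).mono le_sup_right le_rfl).add
    ((comap_measurable (g t)).mono le_sup_left le_rfl)

theorem IsRun.pastWithGuess_le (h : IsRun μ ℱ X P T f gradf g σ xs) (hconv : Convex ℝ X)
    (hm : 0 < m) (ht : t < T) : pastWithGuess X f gradf g (average xs) t ≤ ℱ t :=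
  sup_le (h.guess_measurable t ht).comap_le (h.past_le hconv hm ht)

theorem IsRun.measurable_cumGrad_add (h : IsRun μ ℱ X P T f gradf g σ xs) (hconv : Convex ℝ X)
    (hm : 0 < m) {t : ℕ} (ht : t < T) :
    Measurable[ℱ t] fun ω => cumGrad gradf (average xs) t ω + g t ω :=
  (measurable_cumGrad_add_guess (X := X) (f := f) (average xs) t).mono
    (h.pastWithGuess_le hconv hm ht) le_rfl

end Run

/-! ### Deviation of the played points from their conditional means. -/

section Regret

variable {Ω : Type*} {mΩ : MeasurableSpace Ω} {μ : Measure Ω}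
  {ℱ : Filtration ℕ mΩ} {d m T : ℕ} {N : Seminorm ℝ (E d)}
  {X : Set (E d)} {P : Measure (E d)}
  {f : ℕ → Ω → E d → ℝ} {gradf : ℕ → Ω → E d → E d}
  {g : ℕ → Ω → E d} {σ xs : ℕ → Fin m → Ω → E d} {G l : ℝ}

/-- The expected prediction of round `t` given the past and the guess. -/
def expectedPoint (X : Set (E d)) (P : Measure (E d)) (gradf : ℕ → Ω → E d → E d)
    (g : ℕ → Ω → E d) (x : ℕ → Ω → E d) (t : ℕ) (ω : Ω) : E d :=
  gradPhi X P (cumGrad gradf x t ω + g t ω)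

theorem IsRun.measurable_expectedPoint [IsProbabilityMeasure P]
    (h : IsRun μ ℱ X P T f gradf g σ xs) (hne : X.Nonempty)
    (hc : IsCompact X) (hconv : Convex ℝ X) (hP : P ≪ volume) (hm : 0 < m) {t : ℕ} (ht : t < T) :
    Measurable[ℱ t] (expectedPoint X P gradf g (average xs) t) :=
  (measurable_gradPhi hne hc hP).comp (h.measurable_cumGrad_add hconv hm ht)

/-- The deviation of a single minimizer from its conditional expectation. -/
def deviation (X : Set (E d)) (P : Measure (E d)) (gradf : ℕ → Ω → E d → E d)
    (g : ℕ → Ω → E d) (x : ℕ → Ω → E d) (x₀ : E d) (t : ℕ) (ω : Ω) (s : E d) : E d :=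
  selection X x₀ (cumGrad gradf x t ω + g t ω - s) - expectedPoint X P gradf g x t ω

theorem IsRun.measurable_deviation [IsProbabilityMeasure P]
    (h : IsRun μ ℱ X P T f gradf g σ xs) (hne : X.Nonempty)
    (hc : IsCompact X) (hconv : Convex ℝ X) (hP : P ≪ volume) (hm : 0 < m) (x₀ : E d) {t : ℕ}
    (ht : t < T) : Measurable[MeasurableSpace.prod (ℱ t) inferInstance]
      fun p : Ω × E d => deviation X P gradf g (average xs) x₀ t p.1 p.2 := by
  have h1 : Measurable[MeasurableSpace.prod (ℱ t) inferInstance] fun p : Ω × E d =>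
      cumGrad gradf (average xs) t p.1 + g t p.1 :=
    (h.measurable_cumGrad_add hconv hm ht).comp (@measurable_fst Ω (E d) (ℱ t) inferInstance)
  have h2 : Measurable[MeasurableSpace.prod (ℱ t) inferInstance] fun p : Ω × E d =>
      expectedPoint X P gradf g (average xs) t p.1 :=
    (h.measurable_expectedPoint hne hc hconv hP hm ht).comp
      (@measurable_fst Ω (E d) (ℱ t) inferInstance)
  exact ((measurable_selection X x₀).comp
    (h1.sub (@measurable_snd Ω (E d) (ℱ t) inferInstance))).sub h2

theorem IsRun.ae_average_sub [IsProbabilityMeasure μ] (h : IsRun μ ℱ X P T f gradf g σ xs) (hne : X.Nonempty)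
    (hc : IsCompact X) (hconv : Convex ℝ X) (hP : P ≪ volume) (hm : 0 < m) (x₀ : E d) {t : ℕ}
    (ht : t < T) : ∀ᵐ ω ∂μ, average xs t ω - expectedPoint X P gradf g (average xs) t ω =
      (m : ℝ)⁻¹ • ∑ j, deviation X P gradf g (average xs) x₀ t ω (σ t j ω) := by
  have hm' : (m : ℝ) ≠ 0 := Nat.cast_ne_zero.2 hm.ne'
  filter_upwards [ae_eq_selection hne hc hP (ℱ.le t) (h.pert_sample t ht)
    (h.measurable_cumGrad_add hconv hm ht) (h.point_min t ht) x₀] with ω hω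
  simp only [average, deviation, Finset.sum_sub_distrib, hω]
  rw [smul_sub, Finset.sum_const, Finset.card_univ, Fintype.card_fin,
    ← Nat.cast_smul_eq_nsmul ℝ, smul_smul, inv_mul_cancel₀ hm', one_smul]

variable [IsProbabilityMeasure μ] [IsProbabilityMeasure P]

theorem integral_deviation (hne : X.Nonempty) (hc : IsCompact X) (hP : P ≪ volume)
    (x : ℕ → Ω → E d) {x₀ : E d} (hx₀ : x₀ ∈ X) (t : ℕ) (ω : Ω) :
    ∫ s, deviation X P gradf g x x₀ t ω s ∂P = 0 := by
  simp only [deviation, expectedPoint]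
  rw [integral_sub (integrable_selection hne hc hx₀ _) (integrable_const _),
    gradPhi_eq_integral_selection hne hc hP x₀]
  simp

theorem integrable_deviation (hne : X.Nonempty) (hc : IsCompact X)
    (x : ℕ → Ω → E d) {x₀ : E d} (hx₀ : x₀ ∈ X) (t : ℕ) (ω : Ω) :
    Integrable (deviation X P gradf g x x₀ t ω) P :=
  (integrable_selection hne hc hx₀ _).sub (integrable_const _)

theorem seminorm_deviation_le (hne : X.Nonempty) (hc : IsCompact X) (hconv : Convex ℝ X)
    (hP : P ≪ volume) (x : ℕ → Ω → E d) {x₀ : E d} (hx₀ : x₀ ∈ X) (t : ℕ) (ω : Ω) (s : E d) :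
    N (deviation X P gradf g x x₀ t ω s) ≤ diameter N X :=
  seminorm_sub_le_diameter N hc (selection_mem hne hc hx₀ _) (gradPhi_mem hne hc hconv hP _)

/-- The distance between the average and its conditional expectation is small in every round. -/
theorem IsRun.measure_norm_deviation_gt_le (h : IsRun μ ℱ X P T f gradf g σ xs)
    (hN : ∀ x, N x = 0 → x = 0) (hne : X.Nonempty) (hc : IsCompact X) (hconv : Convex ℝ X)
    (hP : P ≪ volume) (hm : 0 < m) {x₀ : E d} (hx₀ : x₀ ∈ X) (hl : 0 ≤ l) {t : ℕ} (ht : t < T) :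
    μ {ω | 2 * (psi2 N * diameter N X) * √(m * l) <
        ‖∑ j, deviation X P gradf g (average xs) x₀ t ω (σ t j ω)‖} ≤
      ENNReal.ofReal (2 * Real.exp (-l)) :=
  measure_norm_sum_fresh_gt_le (ℱ.le t) (h.pert_sample t ht)
    (h.measurable_deviation hne hc hconv hP hm x₀ ht)
    (fun ω => integral_deviation hne hc hP _ hx₀ t ω)
    (mul_nonneg (psi2_nonneg N) (diameter_nonneg N X))
    (fun ω s => (norm_le_psi2_mul hN _).trans (mul_le_mul_of_nonneg_left
      (seminorm_deviation_le hne hc hconv hP _ hx₀ t ω s) (psi2_nonneg N))) hl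

/-- The gradient is taken at the expected point, not the played one: it is then known to `ℱ t`, and
each summand is centred. -/
theorem IsRun.measure_sum_inner_deviation_gt_le (h : IsRun μ ℱ X P T f gradf g σ xs)
    (hN : ∀ x, N x = 0 → x = 0) (hne : X.Nonempty) (hc : IsCompact X) (hconv : Convex ℝ X)
    (hP : P ≪ volume) (hm : 0 < m) {x₀ : E d} (hx₀ : x₀ ∈ X) (hG0 : 0 ≤ G)
    (hG : ∀ t < T, ∀ ω, ∀ x ∈ X, dualNorm N (gradf t ω x) ≤ G) (hl : 0 ≤ l) :
    μ {ω | 2 * (G * diameter N X) * √(T * m * l) < ∑ t ∈ Finset.range T, ∑ j,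
        inner ℝ (gradf t ω (expectedPoint X P gradf g (average xs) t ω))
          (deviation X P gradf g (average xs) x₀ t ω (σ t j ω))} ≤
      ENNReal.ofReal (Real.exp (-l)) := by
  have hD := diameter_nonneg N X
  refine measure_sum_fresh_gt_le (V := fun t ω s =>
    inner ℝ (gradf t ω (expectedPoint X P gradf g (average xs) t ω))
      (deviation X P gradf g (average xs) x₀ t ω s)) h.pert_sample h.pert_measurable
    (fun t ht => ?_) (fun t ht ω => ?_) (mul_nonneg hG0 hD) (fun t ht ω s => ?_) hl
  · have h1 : Measurable[ℱ t] fun ω =>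
        gradf t ω (expectedPoint X P gradf g (average xs) t ω) :=
      measurable_comp_prodMk (S := fun ω =>
          (⟨expectedPoint X P gradf g (average xs) t ω, gradPhi_mem hne hc hconv hP _⟩ : X)) le_rfl
        ((h.measurable_expectedPoint hne hc hconv hP hm ht).subtype_mk) (h.grad_measurable t ht)
    exact (h1.comp (@measurable_fst Ω (E d) (ℱ t) _)).inner
      (h.measurable_deviation hne hc hconv hP hm x₀ ht)
  · rw [integral_inner (integrable_deviation hne hc _ hx₀ t ω),
      integral_deviation hne hc hP _ hx₀, inner_zero_right]
  · refine (abs_inner_le_dualNorm_mul hN _ _).trans ?_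
    exact mul_le_mul (hG t ht ω _ (gradPhi_mem hne hc hconv hP _))
      (seminorm_deviation_le hne hc hconv hP _ hx₀ t ω s) (apply_nonneg N _) hG0

theorem sqrt_scaling {a : ℝ} (ha : 0 < a) (b : ℝ) : a⁻¹ * √(a * b) = √(b / a) := by
  rw [← Real.sqrt_sq (inv_nonneg.2 ha.le), ← Real.sqrt_mul (sq_nonneg _)]
  congr 1
  field_simp

theorem rpow_deviation_le {r q α : ℝ} (hr : 0 ≤ r) (hα0 : 0 ≤ α) (hα1 : α ≤ 1) (hq : 0 ≤ q)
    (h : r ≤ 2 * √q) : r ^ (1 + α) ≤ 4 * q ^ ((1 + α) / 2) := by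
  calc r ^ (1 + α) ≤ (2 * √q) ^ (1 + α) := Real.rpow_le_rpow hr h (by linarith)
    _ = 2 ^ (1 + α) * q ^ ((1 + α) / 2) := by
        rw [Real.mul_rpow (by norm_num) (Real.sqrt_nonneg q), Real.sqrt_eq_rpow,
          ← Real.rpow_mul hq]
        ring_nf
    _ ≤ 2 ^ (2 : ℝ) * q ^ ((1 + α) / 2) := by
        gcongr
        · norm_num
        · linarith
    _ = 4 * q ^ ((1 + α) / 2) := by norm_num

/-- Subadditivity suffices, so `S` need not be measurable; the event of the theorem involves a
supremum over all of `X`. -/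
theorem ofReal_one_sub_le_of_compl {S : Set Ω} {δ : ℝ} (hδ : 0 ≤ δ)
    (h : μ Sᶜ ≤ ENNReal.ofReal δ) : ENNReal.ofReal (1 - δ) ≤ μ S := by
  rw [ENNReal.ofReal_sub _ hδ, ENNReal.ofReal_one, tsub_le_iff_right]
  calc (1 : ENNReal) = μ (S ∪ Sᶜ) := by rw [Set.union_compl_self, measure_univ]
    _ ≤ μ S + μ Sᶜ := measure_union_le _ _
    _ ≤ μ S + ENNReal.ofReal δ := by gcongr

end Regret

end OFTPL

end

/-! ### The regret bound. -/

theorem mainTheorem10 :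
    ∃ c : ℝ, 0 < c ∧
      ∀ (d : ℕ) (X : Set (OFTPL.E d)) (N : Seminorm ℝ (OFTPL.E d)) (P : Measure (OFTPL.E d))
        (D η C G L α δ : ℝ) (m T : ℕ)
        {Ω : Type*} {mΩ : MeasurableSpace Ω} (μ : Measure Ω) (ℱ : Filtration ℕ mΩ)
        (f : ℕ → Ω → OFTPL.E d → ℝ) (gradf : ℕ → Ω → OFTPL.E d → OFTPL.E d)
        (g : ℕ → Ω → OFTPL.E d) (σ xs τ ys : ℕ → Fin m → Ω → OFTPL.E d),
        -- the decision set, the norm, and the probability space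
        X.Nonempty → IsCompact X → Convex ℝ X →
        (∀ x, N x = 0 → x = 0) →
        IsProbabilityMeasure μ →
        0 < m → 0 < δ → δ < 1 →
        D = OFTPL.diameter N X →
        -- the perturbation distribution and the stability of the predictions
        IsProbabilityMeasure P → P ≪ volume →
        Integrable (OFTPL.dualNorm N) P →
        η = ∫ s, OFTPL.dualNorm N s ∂P →
        0 < C → OFTPL.IsStable X P (OFTPL.dualNorm N) (C * η⁻¹) →
        -- the losses
        (∀ t < T, ∀ ω, ConvexOn ℝ X (f t ω)) →
        (∀ t < T, ∀ ω, ∀ x ∈ X, HasGradientWithinAt (f t ω) (gradf t ω x) X x) →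
        (∀ t < T, ∀ ω, ∀ x ∈ X, ∀ y ∈ X, |f t ω x - f t ω y| ≤ G * N (x - y)) →
        (∀ t < T, ∀ ω, ∀ x ∈ X, OFTPL.dualNorm N (gradf t ω x) ≤ G) →
        0 ≤ α → α ≤ 1 →
        (∀ t < T, ∀ ω, ∀ x ∈ X, ∀ y ∈ X,
          OFTPL.dualNorm N (gradf t ω x - gradf t ω y) ≤ L * N (x - y) ^ α) →
        -- the algorithm, and its predictions with guess zero
        OFTPL.IsRun μ ℱ X P T f gradf g σ xs →
        OFTPL.IsZeroGuessRun μ X P T f gradf (OFTPL.average xs) τ ys →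
        -- the regret bound
        ENNReal.ofReal (1 - δ) ≤ μ {ω |
          OFTPL.regret X T f (OFTPL.average xs) ω ≤
            η * D
            + ∑ t ∈ Finset.range T, C / (2 * η) *
                OFTPL.dualNorm N (OFTPL.gradAt gradf (OFTPL.average xs) t ω - g t ω) ^ 2
            - ∑ t ∈ Finset.range T, η / (2 * C) *
                N ((μ[OFTPL.average xs t |
                      OFTPL.pastWithGuess X f gradf g (OFTPL.average xs) t]) ω
                  - (μ[OFTPL.average ys t |
                      OFTPL.past X f gradf (OFTPL.average xs) t]) ω) ^ 2
            + c * G * D * Real.sqrt (T * Real.log (2 / δ) / m)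
            + c * L * T *
                (OFTPL.psi1 N ^ 2 * OFTPL.psi2 N ^ 2 * D ^ 2 * Real.log (4 * T / δ) / m)
                  ^ ((1 + α) / 2)} := by
  -- The Hölder term needs `2 ^ (1 + α) ≤ 4`; the martingale term needs only `2`.
  refine ⟨4, by norm_num, ?_⟩
  intro d X N P D η C G L α δ m T Ω mΩ μ ℱ f gradf g σ xs τ ys hne hc hconv hN hμ hm hδ0 hδ1 hD
    hPp hP hint hη hC hstab hconvex hgrad hlip hG hα0 hα1 hL hrun hzero
  obtain ⟨x₀, hx₀⟩ := id hne
  have hm' : (0 : ℝ) < m := Nat.cast_pos.2 hm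
  have hD0 : 0 ≤ D := hD ▸ OFTPL.diameter_nonneg N X
  have hη0 : 0 ≤ η := hη ▸ integral_nonneg fun s => OFTPL.dualNorm_nonneg hN s
  set x := OFTPL.average xs with hx
  have hXne : Nonempty X := hne.to_subtype
  -- Without rounds there is no loss from which to read off `0 ≤ G`, but the regret is an empty sum.
  rcases Nat.eq_zero_or_pos T with rfl | hT
  · refine OFTPL.ofReal_one_sub_le_of_compl hδ0.le ?_
    refine le_of_eq_of_le (measure_mono_null (t := ∅) (fun ω hω => hω ?_) measure_empty) zero_le
    change OFTPL.regret X 0 f x ω ≤ _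
    simpa [OFTPL.regret] using mul_nonneg hη0 hD0
  have hT' : (1 : ℝ) ≤ T := Nat.one_le_cast.2 hT
  obtain ⟨ω₀⟩ : Nonempty Ω := μ.nonempty_of_neZero
  have hG0 : 0 ≤ G := (OFTPL.dualNorm_nonneg hN _).trans (hG 0 hT ω₀ x₀ hx₀)
  -- These levels make the failure probabilities `δ / 2` for the martingale and `δ / (2 * T)` for
  -- each round.
  set l₁ := Real.log (2 / δ) with hl₁
  set l₂ := Real.log (4 * T / δ) with hl₂
  have hl₁0 : 0 ≤ l₁ := Real.log_nonneg (by rw [le_div_iff₀ hδ0]; linarith)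
  have hl₂0 : 0 ≤ l₂ := Real.log_nonneg (by rw [le_div_iff₀ hδ0]; linarith)
  have he₁ : Real.exp (-l₁) = δ / 2 := by
    rw [Real.exp_neg, hl₁, Real.exp_log (by positivity), inv_div]
  have he₂ : 2 * Real.exp (-l₂) = δ / (2 * T) := by
    rw [Real.exp_neg, hl₂, Real.exp_log (by positivity), inv_div]
    field_simp
    norm_num
  set z := OFTPL.expectedPoint X P gradf g x with hz
  set w := OFTPL.deviation X P gradf g x x₀ with hw
  set B₁ := {ω | 2 * (G * D) * √(T * m * l₁) < ∑ t ∈ Finset.range T, ∑ j,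
    inner ℝ (gradf t ω (z t ω)) (w t ω (σ t j ω))} with hB₁
  set B₂ : ℕ → Set Ω := fun t => {ω | 2 * (OFTPL.psi2 N * D) * √(m * l₂) <
    ‖∑ j, w t ω (σ t j ω)‖} with hB₂
  have hμB₁ : μ B₁ ≤ ENNReal.ofReal (δ / 2) := by
    rw [← he₁, hB₁, hD]
    exact hrun.measure_sum_inner_deviation_gt_le hN hne hc hconv hP hm hx₀ hG0 hG hl₁0
  have hμB₂ : ∀ t < T, μ (B₂ t) ≤ ENNReal.ofReal (δ / (2 * T)) := fun t ht => by
    rw [← he₂, hB₂, hD]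
    exact hrun.measure_norm_deviation_gt_le hN hne hc hconv hP hm hx₀ hl₂0 ht
  have hae : ∀ᵐ ω ∂μ, ∀ t < T, x t ω - z t ω = (m : ℝ)⁻¹ • ∑ j, w t ω (σ t j ω) ∧
      (μ[x t | OFTPL.pastWithGuess X f gradf g x t]) ω = z t ω ∧
      (μ[OFTPL.average ys t | OFTPL.past X f gradf x t]) ω =
        OFTPL.gradPhi X P (OFTPL.cumGrad gradf x t ω) := by
    refine ae_all_iff.2 fun t => ?_
    by_cases ht : t < T
    · have hle := hrun.pastWithGuess_le hconv hm ht
      filter_upwards [hrun.ae_average_sub hne hc hconv hP hm x₀ ht,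
        OFTPL.condExp_average_eq hne hc hP hm (hle.trans (ℱ.le t))
          ((hrun.pert_sample t ht).mono hle) (OFTPL.measurable_cumGrad_add_guess x t)
          (hrun.point_min t ht),
        OFTPL.condExp_average_eq hne hc hP hm ((hrun.past_le hconv hm ht).trans (ℱ.le t))
          (hzero.pert_sample t ht) (OFTPL.measurable_cumGrad_past x t)
          (hzero.point_min t ht)] with ω h1 h2 h3 _
      exact ⟨h1, h2, h3⟩
    · exact Filter.Eventually.of_forall fun ω h => absurd h ht
  refine OFTPL.ofReal_one_sub_le_of_compl hδ0.le ?_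
  set A : Set Ω := {ω | ¬ ∀ t < T, x t ω - z t ω = (m : ℝ)⁻¹ • ∑ j, w t ω (σ t j ω) ∧
      (μ[x t | OFTPL.pastWithGuess X f gradf g x t]) ω = z t ω ∧
      (μ[OFTPL.average ys t | OFTPL.past X f gradf x t]) ω =
        OFTPL.gradPhi X P (OFTPL.cumGrad gradf x t ω)} with hA
  have hμA : μ A = 0 := ae_iff.1 hae
  have hbad : μ (A ∪ (B₁ ∪ ⋃ t ∈ Finset.range T, B₂ t)) ≤ ENNReal.ofReal δ := by
    have hU : μ (⋃ t ∈ Finset.range T, B₂ t) ≤ ENNReal.ofReal (δ / 2) := by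
      calc μ (⋃ t ∈ Finset.range T, B₂ t) ≤ ∑ t ∈ Finset.range T, μ (B₂ t) :=
            measure_biUnion_finset_le _ _
        _ ≤ ∑ _t ∈ Finset.range T, ENNReal.ofReal (δ / (2 * T)) :=
            Finset.sum_le_sum fun t ht => hμB₂ t (Finset.mem_range.1 ht)
        _ = ENNReal.ofReal (δ / 2) := by
            rw [Finset.sum_const, Finset.card_range, ← ENNReal.ofReal_nsmul, nsmul_eq_mul]
            congr 1
            field_simp
    calc μ (A ∪ (B₁ ∪ ⋃ t ∈ Finset.range T, B₂ t))
        ≤ μ A + (μ B₁ + μ (⋃ t ∈ Finset.range T, B₂ t)) :=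
          (measure_union_le _ _).trans (add_le_add le_rfl (measure_union_le _ _))
      _ ≤ 0 + (ENNReal.ofReal (δ / 2) + ENNReal.ofReal (δ / 2)) :=
          add_le_add hμA.le (add_le_add hμB₁ hU)
      _ = ENNReal.ofReal δ := by
          rw [zero_add, ← ENNReal.ofReal_add (by positivity) (by positivity), add_halves]
  refine (measure_mono (Set.compl_subset_comm.1 fun ω hω => ?_)).trans hbad
  rw [Set.mem_compl_iff, Set.mem_union, Set.mem_union, not_or, not_or] at hω
  obtain ⟨hωA, hω₁, hω₂⟩ := hω
  have hgood : ∀ t < T, x t ω - z t ω = (m : ℝ)⁻¹ • ∑ j, w t ω (σ t j ω) ∧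
      (μ[x t | OFTPL.pastWithGuess X f gradf g x t]) ω = z t ω ∧
      (μ[OFTPL.average ys t | OFTPL.past X f gradf x t]) ω =
        OFTPL.gradPhi X P (OFTPL.cumGrad gradf x t ω) := not_not.1 hωA
  have hdev₁ : ∑ t ∈ Finset.range T, inner ℝ (gradf t ω (z t ω)) (x t ω - z t ω) ≤
      4 * G * D * √(T * l₁ / m) := by
    have h1 : ∑ t ∈ Finset.range T, ∑ j, inner ℝ (gradf t ω (z t ω)) (w t ω (σ t j ω)) ≤
        2 * (G * D) * √(T * m * l₁) := not_lt.1 hω₁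
    have h2 : ∑ t ∈ Finset.range T, inner ℝ (gradf t ω (z t ω)) (x t ω - z t ω) =
        (m : ℝ)⁻¹ * ∑ t ∈ Finset.range T, ∑ j,
          inner ℝ (gradf t ω (z t ω)) (w t ω (σ t j ω)) := by
      rw [Finset.mul_sum]
      refine Finset.sum_congr rfl fun t ht => ?_
      rw [(hgood t (Finset.mem_range.1 ht)).1, inner_smul_right, inner_sum]
    rw [h2]
    calc _ ≤ (m : ℝ)⁻¹ * (2 * (G * D) * √(T * m * l₁)) := by gcongr
      _ = 2 * (G * D) * ((m : ℝ)⁻¹ * √(m * (T * l₁))) := by ring_nf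
      _ = 2 * (G * D) * √(T * l₁ / m) := by
          rw [OFTPL.sqrt_scaling hm']
      _ ≤ 4 * G * D * √(T * l₁ / m) := by
          have : 0 ≤ G * D * √(T * l₁ / m) := by positivity
          linarith
  set q := OFTPL.psi1 N ^ 2 * OFTPL.psi2 N ^ 2 * D ^ 2 * l₂ / m with hq
  have hq0 : 0 ≤ q := by positivity
  have hdev₂ : ∀ t < T, N (x t ω - z t ω) ≤ 2 * √q := fun t ht => by
    have h1 : ‖∑ j, w t ω (σ t j ω)‖ ≤ 2 * (OFTPL.psi2 N * D) * √(m * l₂) := by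
      refine not_lt.1 fun h => hω₂ ?_
      exact Set.mem_biUnion (Finset.mem_coe.2 (Finset.mem_range.2 ht)) h
    have hψ₁ := OFTPL.psi1_nonneg N
    have hψ₂ := OFTPL.psi2_nonneg N
    have hsq : √q = OFTPL.psi1 N * OFTPL.psi2 N * D * √(l₂ / m) := by
      have : q = (OFTPL.psi1 N * OFTPL.psi2 N * D) ^ 2 * (l₂ / m) := by
        rw [hq]
        ring
      rw [this, Real.sqrt_mul (sq_nonneg _), Real.sqrt_sq (by positivity)]
    rw [(hgood t ht).1]
    calc N ((m : ℝ)⁻¹ • ∑ j, w t ω (σ t j ω))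
        ≤ OFTPL.psi1 N * ‖(m : ℝ)⁻¹ • ∑ j, w t ω (σ t j ω)‖ := OFTPL.seminorm_le_psi1_mul N _
      _ = OFTPL.psi1 N * ((m : ℝ)⁻¹ * ‖∑ j, w t ω (σ t j ω)‖) := by
          rw [norm_smul, norm_inv, Real.norm_natCast]
      _ ≤ OFTPL.psi1 N * ((m : ℝ)⁻¹ * (2 * (OFTPL.psi2 N * D) * √(m * l₂))) := by gcongr
      _ = 2 * (OFTPL.psi1 N * OFTPL.psi2 N * D * ((m : ℝ)⁻¹ * √(m * l₂))) := by ring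
      _ = 2 * √q := by rw [OFTPL.sqrt_scaling hm', hsq]
  have hzX : ∀ t, z t ω ∈ X := fun t => OFTPL.gradPhi_mem hne hc hconv hP _
  have hxX : ∀ t < T, x t ω ∈ X := fun t ht => hrun.average_mem hconv hm ht ω
  have hdev₃ : ∑ t ∈ Finset.range T, L * N (x t ω - z t ω) ^ (1 + α) ≤
      4 * L * T * q ^ ((1 + α) / 2) := by
    have h1 : ∀ t ∈ Finset.range T,
        L * N (x t ω - z t ω) ^ (1 + α) ≤ L * (4 * q ^ ((1 + α) / 2)) := fun t ht => by
      have h2 := OFTPL.rpow_deviation_le (apply_nonneg N _) hα0 hα1 hq0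
        (hdev₂ t (Finset.mem_range.1 ht))
      -- For negative `L` the inequality would reverse, but then `D = 0` and both sides vanish.
      rcases le_or_gt 0 L with hL0 | hL0
      · gcongr
      · have hDz : D = 0 := hD.trans
          (OFTPL.diameter_eq_zero_of_neg hN hL0 (hL 0 hT ω))
        have hqz : q = 0 := by rw [hq, hDz]; simp
        rw [hqz, Real.zero_rpow (by positivity)] at h2 ⊢
        have h3 := Real.rpow_nonneg (apply_nonneg N (x t ω - z t ω)) (1 + α)
        have h4 : N (x t ω - z t ω) ^ (1 + α) = 0 := by linarith
        simp [h4]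
    refine (Finset.sum_le_sum h1).trans (le_of_eq ?_)
    rw [Finset.sum_const, Finset.card_range, nsmul_eq_mul]
    ring
  change OFTPL.regret X T f x ω ≤ _
  -- The good event does not depend on the comparator, so each `y` can be treated on the same path.
  refine ciSup_le fun y => ?_
  have h1 := OFTPL.sum_loss_sub_le hN (F := fun t => f t ω) (v := fun t => gradf t ω)
    (x := fun t => x t ω) (z := fun t => z t ω) hα0 (fun t ht => hconvex t ht ω) hxX
    (fun t _ => hzX t) y.2 (fun t ht => hgrad t ht ω) (fun t ht => hL t ht ω)
  have h2 := OFTPL.linear_regret_le hN hne hc hP hint hη hC hstab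
    (fun t => OFTPL.gradAt gradf x t ω) (fun t => g t ω) T y.2
  have h3 : ∑ t ∈ Finset.range T, η / (2 * C) *
        N ((μ[x t | OFTPL.pastWithGuess X f gradf g x t]) ω
          - (μ[OFTPL.average ys t | OFTPL.past X f gradf x t]) ω) ^ 2 =
      ∑ t ∈ Finset.range T, η / (2 * C) *
        N (z t ω - OFTPL.gradPhi X P (OFTPL.cumGrad gradf x t ω)) ^ 2 :=
    Finset.sum_congr rfl fun t ht => by
      rw [(hgood t (Finset.mem_range.1 ht)).2.1, (hgood t (Finset.mem_range.1 ht)).2.2]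
  rw [h3]
  rw [← hD] at h2
  have h4 : ∑ t ∈ Finset.range T, inner ℝ (gradf t ω (x t ω)) (z t ω - y.1) ≤
      η * D + ∑ t ∈ Finset.range T, C / (2 * η) *
          OFTPL.dualNorm N (OFTPL.gradAt gradf x t ω - g t ω) ^ 2
        - ∑ t ∈ Finset.range T, η / (2 * C) *
          N (z t ω - OFTPL.gradPhi X P (OFTPL.cumGrad gradf x t ω)) ^ 2 := h2
  linarith
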